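/- **Problem.** A stream is a finite sequence $L=(p_1,\dots,p_n)$ of pieces, where $p_i$ is a rectangle of width $w_i>0$ and height $h_i>0$. A packing of $L$ places the pieces in the plane as axis-parallel rectangles by translation only (no rotation), with pairwise disjoint interiors. Its cost is the perimeter of the axis-parallel bounding box of the placed pieces, and $\mathrm{Opt}(L)$ is the minimum cost of a packing of $L$ (infimum over all packings). Pieces arrive one by one and must be placed irrevocably on arrival. The algorithm has competitive ratio $c$ if on every non-empty stream $L$ it produces a packing of $L$ of cost at most $c\cdot \mathrm{Opt}(L)$. **Bricks.** For $k\in\mathbb Z$, a $k$-brick is an axis-parallel rectangle of width $\times$ height $\sqrt2^{\,-k}\times\sqrt2^{\,-k-1}$ if $k$ is even, and $\sqrt2^{\,-k-1}\times\sqrt2^{\,-k}$ if $k$ is odd. The fundamental brick $B_k$ is the $k$-brick with lower left corner $(0,\sqrt2^{\,-k-1})$ if $k$ is even and $(\sqrt2^{\,-k-1},0)$ if $k$ is odd. A $k$-brick $B$ splits into two $(k+1)$-bricks $B\dagger1$ and $B\dagger2$: the left and right halves if $k$ is even, the lower and upper halves if $k$ is odd. The derived bricks are the bricks $B_i\dagger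 b_1\dagger\cdots\dagger b_\ell$ with $i\in\mathbb Z$, $\ell\ge0$, $b_j\in\{1,2\}$; this is a $k$-brick for $k=i+\ell$. Derived $k$-bricks are ordered by $B_i\dagger b_1\dagger\cdots\dagger b_{k-i}\prec B_j\dagger b'_1\dagger\cdots\dagger b'_{k-j}$ if $i>j$, or $i=j$ and $(b_1,\dots,b_{k-i})$ precedes $(b'_1,\dots,b'_{k-i})$ lexicographically. A $k$-brick is suitable for a piece of size $w\times h$ if its width and height are at least $w$ and $h$, respectively, and this fails for a $(k+1)$-brick. **Algorithm BrickTranslation.** It maintains the collection $\mathcal D$ of the derived bricks in which pieces have been placed; initially $\mathcal D=\emptyset$. Inside a $k$-brick $D$, the first piece is placed with its lower left corner at the lower left corner of $D$; each later piece is placed on top of the previous one, at the left edge of $D$, if $k$ is even, and to the right of the previous one, at the bottom edge of $D$, if $k$ is odd. The brick $D$ has room for $p$ if this places $p$ within $D$. When a piece $p$ arrives, let $k$ be such that a $k$-brick is suitable for $p$. If some $k$-brick $D\in\mathcal D$ has room for $p$, then $p$ is packed in such a $D$ (if there are several, any of them may be chosen). Otherwise let $D$ be the $\prec$-minimum derived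 $k$-brick that is interior-disjoint from every brick in $\mathcal D$; then $D$ is added to $\mathcal D$ and $p$ is packed in $D$. **Theorem.** The algorithm BrickTranslation is well defined (it can always pack the next piece), and it has a competitive ratio strictly less than $4$: there is a constant $c<4$ such that, for every non-empty stream $L$ and all choices the algorithm may make, it produces a packing of $L$ whose bounding box has perimeter at most $c\cdot\mathrm{Opt}(L)$. -/

import Mathlib

namespace BrickPacking

open Set

/-! ### Pieces, packings and the perimeter problem with translations -/

/-- A rectangular piece, given by its (positive) width and height. -/
structure Piece where
  width : ℝ
  height : ℝ
  width_pos : 0 < width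
  height_pos : 0 < height

/-- The closed axis-parallel `w × h` rectangle with lower left corner `q`. -/
def rectangle (q : ℝ × ℝ) (w h : ℝ) : Set (ℝ × ℝ) :=
  Icc q.1 (q.1 + w) ×ˢ Icc q.2 (q.2 + h)

/-- A piece together with the position of its lower left corner in the plane
(pieces are translated, never rotated). -/
structure PlacedPiece where
  piece : Piece
  pos : ℝ × ℝ

/-- The region of the plane covered by a placed piece. -/
def PlacedPiece.region (q : PlacedPiece) : Set (ℝ × ℝ) :=
  rectangle q.pos q.piece.width q.piece.height

/-- Two subsets of the plane are interior-disjoint. -/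
def InteriorDisjoint (S T : Set (ℝ × ℝ)) : Prop :=
  Disjoint (interior S) (interior T)

/-- `P` is a packing of the stream `L` by translations: it places the pieces of `L` (in the order of
the stream) anywhere in the plane without overlap. -/
def IsPacking (L : List Piece) (P : List PlacedPiece) : Prop :=
  P.map PlacedPiece.piece = L ∧ P.Pairwise fun q r => InteriorDisjoint q.region r.region

/-- The perimeter of the axis-parallel bounding box of a (nonempty bounded) set in the plane. -/
noncomputable def boundingBoxPerimeter (S : Set (ℝ × ℝ)) : ℝ :=
  2 * ((sSup (Prod.fst '' S) - sInf (Prod.fst '' S)) +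
    (sSup (Prod.snd '' S) - sInf (Prod.snd '' S)))

/-- The cost of a packing: the perimeter of the axis-parallel bounding box of its pieces. -/
noncomputable def cost (P : List PlacedPiece) : ℝ :=
  boundingBoxPerimeter (⋃ q ∈ P, q.region)

/-- The optimal offline cost of a stream. -/
noncomputable def opt (L : List Piece) : ℝ :=
  sInf {x : ℝ | ∃ P, IsPacking L P ∧ cost P = x}

/-- `c` is an (absolute) competitive ratio for the perimeter problem with translations of an
algorithm `A`, where `A L P` means that `A` may output `P` on the stream `L`: on every nonempty
stream, each output is a packing of the stream and costs at most `c` times the optimum. -/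
def HasCompetitiveRatio (A : List Piece → List PlacedPiece → Prop) (c : ℝ) : Prop :=
  ∀ L : List Piece, L ≠ [] → ∀ P, A L P → IsPacking L P ∧ cost P ≤ c * opt L

/-! ### Bricks -/

/-- The width of a `k`-brick. -/
noncomputable def brickWidth (k : ℤ) : ℝ :=
  if Even k then √2 ^ (-k) else √2 ^ (-k - 1)

/-- The height of a `k`-brick. -/
noncomputable def brickHeight (k : ℤ) : ℝ :=
  if Even k then √2 ^ (-k - 1) else √2 ^ (-k)

/-- A `k`-brick in the plane, for `k = level`, given by its lower left corner. -/
structure Brick where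
  level : ℤ
  corner : ℝ × ℝ

/-- The region of the plane covered by a brick. -/
noncomputable def Brick.region (B : Brick) : Set (ℝ × ℝ) :=
  rectangle B.corner (brickWidth B.level) (brickHeight B.level)

/-- The fundamental brick `B_k`. The fundamental bricks tile the positive quadrant. -/
noncomputable def fundamentalBrick (k : ℤ) : Brick where
  level := k
  corner := if Even k then (0, √2 ^ (-k - 1)) else (√2 ^ (-k - 1), 0)

/-- The two halves of a `k`-brick, which are `(k+1)`-bricks. `B.split false` is `B † 1`: the left half
if `k` is even, the lower half if `k` is odd. `B.split true` is the other half `B † 2`. -/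
noncomputable def Brick.split (B : Brick) (b : Bool) : Brick where
  level := B.level + 1
  corner :=
    if b then
      if Even B.level then (B.corner.1 + brickWidth (B.level + 1), B.corner.2)
      else (B.corner.1, B.corner.2 + brickHeight (B.level + 1))
    else B.corner

/-- A derived brick `B_i † b₁ † ⋯ † b_ℓ`, with `i = root` and `[b₁, …, b_ℓ] = path`
(`false` stands for `1` and `true` for `2`). -/
@[ext]
structure DerivedBrick where
  root : ℤ
  path : List Bool

namespace DerivedBrick

/-- The brick in the plane that a derived brick denotes. -/
noncomputable def toBrick (D : DerivedBrick) : Brick :=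
  D.path.foldl Brick.split (fundamentalBrick D.root)

/-- The `k` for which `D` is a `k`-brick. -/
def level (D : DerivedBrick) : ℤ := D.root + D.path.length

/-- The two descriptions of the level of a derived brick agree. -/
theorem toBrick_level (D : DerivedBrick) : D.toBrick.level = D.level := by
  have key : ∀ (l : List Bool) (B : Brick),
      (l.foldl Brick.split B).level = B.level + l.length := by
    intro l
    induction l with
    | nil => intro B; simp
    | cons b l ih =>
      intro B
      rw [List.foldl_cons, ih]
      simp only [Brick.split, List.length_cons]
      push_cast
      ring
  exact key D.path (fundamentalBrick D.root)

/-- The region of the plane covered by a derived brick. -/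
noncomputable def region (D : DerivedBrick) : Set (ℝ × ℝ) := D.toBrick.region

/-- The ordering `≺`, used only between derived bricks of the same level: a larger index of the
surrounding fundamental brick comes first, ties are broken lexicographically by the splits. -/
def Prec (D₁ D₂ : DerivedBrick) : Prop :=
  D₂.root < D₁.root ∨ D₁.root = D₂.root ∧ List.Lex (· < ·) D₁.path D₂.path

end DerivedBrick

/-- `k`-bricks are suitable for `p`: `p` fits in a `k`-brick but not in a `(k+1)`-brick. -/
def Suitable (k : ℤ) (p : Piece) : Prop :=
  (p.width ≤ brickWidth k ∧ p.height ≤ brickHeight k) ∧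
    ¬ (p.width ≤ brickWidth (k + 1) ∧ p.height ≤ brickHeight (k + 1))

/-! ### The algorithm BrickTranslation -/

/-- A piece placed by the algorithm, with the derived brick in which it is packed. -/
structure PackedPiece extends PlacedPiece where
  brick : DerivedBrick

/-- A state of the algorithm: the pieces packed so far, in order of arrival. -/
abbrev State := List PackedPiece

namespace State

/-- The collection `𝒟` of the derived bricks in which pieces have been placed. -/
def bricks (S : State) : Set DerivedBrick := {D | ∃ e ∈ S, e.brick = D}

open Classical in
/-- The pieces that are packed in `D`. -/
noncomputable def piecesIn (S : State) (D : DerivedBrick) : List Piece :=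
  (S.filter fun e => e.brick = D).map fun e => e.piece

/-- The position at which the next piece would be packed in `D`: on top of the previous pieces,
at the left edge of `D`, if `D` is a `k`-brick with `k` even, and to the right of the previous
pieces, at the bottom edge of `D`, if `k` is odd. -/
noncomputable def nextPos (S : State) (D : DerivedBrick) : ℝ × ℝ :=
  if Even D.level then
    (D.toBrick.corner.1, D.toBrick.corner.2 + ((S.piecesIn D).map Piece.height).sum)
  else
    (D.toBrick.corner.1 + ((S.piecesIn D).map Piece.width).sum, D.toBrick.corner.2)

/-- `D` has room for `p`: the packing scheme places `p` within `D`. -/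
def HasRoom (S : State) (D : DerivedBrick) (p : Piece) : Prop :=
  rectangle (S.nextPos D) p.width p.height ⊆ D.region

/-- `D` is interior-disjoint from each brick in `𝒟`. -/
def Free (S : State) (D : DerivedBrick) : Prop :=
  ∀ E ∈ S.bricks, InteriorDisjoint D.region E.region

/-- `D` is the `≺`-minimum of the free derived `k`-bricks. -/
def IsMinFree (S : State) (k : ℤ) (D : DerivedBrick) : Prop :=
  D.level = k ∧ S.Free D ∧ ∀ E : DerivedBrick, E.level = k → S.Free E → E ≠ D → D.Prec E

/-- The algorithm may pack the next piece `p` in `D`, where `k`-bricks are suitable for `p`: `D` is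
some `k`-brick in `𝒟` with room for `p`, and if there is none, `D` is the minimum free derived
`k`-brick. -/
def Chooses (S : State) (p : Piece) (D : DerivedBrick) : Prop :=
  ∃ k : ℤ, Suitable k p ∧
    ((D ∈ S.bricks ∧ D.level = k ∧ S.HasRoom D p) ∨
      ((¬ ∃ E ∈ S.bricks, E.level = k ∧ S.HasRoom E p) ∧ S.IsMinFree k D))

/-- The state after packing `p` in `D`. -/
noncomputable def pack (S : State) (p : Piece) (D : DerivedBrick) : State :=
  S ++ [{ piece := p, pos := S.nextPos D, brick := D }]

end State

/-- `Run L S`: the algorithm may be in state `S` after processing the stream `L`. Nothing is assumed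
on how it chooses among several bricks of `𝒟` with room for a piece. -/
inductive Run : List Piece → State → Prop
  | nil : Run [] []
  | step {L : List Piece} {S : State} {p : Piece} {D : DerivedBrick} :
      Run L S → S.Chooses p D → Run (L ++ [p]) (S.pack p D)

/-- The algorithm BrickTranslation: `BrickTranslation L P` means that it may pack the stream `L`
as in `P`. -/
def BrickTranslation (L : List Piece) (P : List PlacedPiece) : Prop :=
  ∃ S : State, Run L S ∧ P = S.map PackedPiece.toPlacedPiece

end BrickPacking

/-!
The derived `k`-bricks are numbered by the positive integers in the order `≺`: the code of a brick
is a leading binary digit `1` followed by its splits. A `k`-brick of code `n` thus becomes the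
dyadic interval `[n / 2 ^ k, (n + 1) / 2 ^ k)` of the positive half-line, inclusion of bricks
becomes inclusion of intervals, and `≺` becomes the order of the integers. In particular `≺` is a
well-order on each level, and since finitely many bricks leave a large fundamental brick free, the
next piece can always be packed (`State.exists_chooses`).

Three invariants of a run (`State.Good`) give the competitive ratio. A piece in a brick of even
level is wider than half of it, and one in a brick of odd level is higher than half of it. Two
bricks in use of a common level are together filled more than once in the stacking direction, so a
level with at least two bricks has density at least `1 / 4` (`Layout.card_mul_le_levelArea`).
Finally, no brick preceding a brick in use of the same level is free. The last invariant implies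
that a piece in the brick of level `m` and code `n` forces the bricks in use up to that brick to
have measure at least `n / 2 ^ m` (`Dyadic.FirstFit.le_sum`): the maximal free intervals before it
have pairwise distinct lengths. As a level is sparse only if it has a single brick, the total area
of the pieces, and with it the perimeter of any packing, is bounded from below
(`Layout.levelArea_add_le_area`).

The cost of the packing is at most twice the sum of the right end of one piece and the upper end
of another. A reflection in the diagonal with a scaling by an odd power of `√2` permutes the
bricks (`Layout.shift`), so the largest fundamental brick around these two pieces may be taken to
be `B₀`, and the box has half-perimeter at most `1 + √2`. Any packing fits in a box of width `W`
and height `H` that is as wide and as high as each piece and has at least the total area. If a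
piece of level `1` and a piece of level `2` are present, then `H ≥ √2 / 4` and `W ≥ 1 / 4`, which
yields just the ratio `4`; the ratio improves to `3.96` because a box that is nearly tight in
both directions can only reach the top and the right end of the quadrant if more bricks are dense
(`Layout.bound_normalized`).
-/

namespace BrickPacking

open Set

/-! ### Codes of derived bricks -/

/-- Reading the binary digits `l` after the binary number `n`. -/
def appendBits (n : ℕ) (l : List Bool) : ℕ := l.foldl (fun n b => 2 * n + b.toNat) n

@[simp] theorem appendBits_nil (n : ℕ) : appendBits n [] = n := rfl

@[simp] theorem appendBits_cons (n : ℕ) (b : Bool) (l : List Bool) :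
    appendBits n (b :: l) = appendBits (2 * n + b.toNat) l := rfl

theorem appendBits_append (n : ℕ) (l l' : List Bool) :
    appendBits n (l ++ l') = appendBits (appendBits n l) l' := by
  simp [appendBits]

theorem appendBits_bounds (l : List Bool) : ∀ n : ℕ,
    n * 2 ^ l.length ≤ appendBits n l ∧ appendBits n l < (n + 1) * 2 ^ l.length := by
  induction l with
  | nil => intro n; simp
  | cons b l ih =>
    intro n
    obtain ⟨h1, h2⟩ := ih (2 * n + b.toNat)
    have hb : b.toNat ≤ 1 := Bool.toNat_le b
    rw [appendBits_cons, List.length_cons, pow_succ]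
    have hp : 0 < 2 ^ l.length := by positivity
    constructor
    · nlinarith
    · nlinarith

theorem appendBits_div (n : ℕ) (l : List Bool) : appendBits n l / 2 ^ l.length = n := by
  obtain ⟨h1, h2⟩ := appendBits_bounds l n
  exact Nat.div_eq_of_lt_le h1 h2

theorem lex_iff_appendBits_lt : ∀ (l l' : List Bool) (n : ℕ), l.length = l'.length →
    (List.Lex (· < ·) l l' ↔ appendBits n l < appendBits n l')
  | [], [], n, _ => by simp
  | b :: l, b' :: l', n, h => by
    have hl : l.length = l'.length := by simpa using h
    rw [List.cons_lex_cons_iff, appendBits_cons, appendBits_cons]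
    have h0 := appendBits_bounds l (2 * n)
    have h0' := appendBits_bounds l' (2 * n)
    have h1 := appendBits_bounds l (2 * n + 1)
    have h1' := appendBits_bounds l' (2 * n + 1)
    rw [hl] at h0 h1
    cases b <;> cases b'
    · simpa using lex_iff_appendBits_lt l l' (2 * n) hl
    · refine iff_of_true (by simp) ?_
      simp only [Bool.toNat_false, Bool.toNat_true, add_zero]
      omega
    · refine iff_of_false (by simp) ?_
      simp only [Bool.toNat_false, Bool.toNat_true, add_zero]
      omega
    · simpa using lex_iff_appendBits_lt l l' (2 * n + 1) hl

theorem appendBits_injective : ∀ (l l' : List Bool) (n : ℕ), l.length = l'.length →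
    appendBits n l = appendBits n l' → l = l'
  | [], [], n, _, _ => rfl
  | b :: l, b' :: l', n, h, he => by
    have hl : l.length = l'.length := by simpa using h
    rw [appendBits_cons, appendBits_cons] at he
    have hd : 2 * n + b.toNat = 2 * n + b'.toNat := by
      rw [← appendBits_div (2 * n + b.toNat) l, ← appendBits_div (2 * n + b'.toNat) l', he, hl]
    have hb : b = b' := by cases b <;> cases b' <;> simp_all
    subst hb
    rw [appendBits_injective l l' _ hl he]

theorem exists_appendBits (n : ℕ) (hn : 1 ≤ n) : ∃ l : List Bool, appendBits 1 l = n := by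
  induction n using Nat.strong_induction_on with
  | _ n ih =>
    rcases Nat.lt_or_ge n 2 with h | h
    · exact ⟨[], by simp; omega⟩
    · obtain ⟨l, hl⟩ := ih (n / 2) (by omega) (by omega)
      refine ⟨l ++ [decide (n % 2 = 1)], ?_⟩
      rw [appendBits_append, hl]
      rcases Nat.mod_two_eq_zero_or_one n with h' | h' <;> simp [h'] <;> omega

namespace DerivedBrick

/-- The position of a derived brick in the `≺`-order of its level: the binary number whose digits
are a leading `1` followed by the splits. The derived `k`-bricks are thereby numbered by the
positive integers, and `D` corresponds to the dyadic interval `[n / 2 ^ k, (n + 1) / 2 ^ k)`,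
where `n = D.code`. -/
def code (D : DerivedBrick) : ℕ := appendBits 1 D.path

theorem code_bounds (D : DerivedBrick) :
    2 ^ D.path.length ≤ D.code ∧ D.code < 2 * 2 ^ D.path.length := by
  simpa [code] using appendBits_bounds D.path 1

theorem prec_iff_code_lt {D E : DerivedBrick} (h : D.level = E.level) :
    D.Prec E ↔ D.code < E.code := by
  have hD := D.code_bounds
  have hE := E.code_bounds
  simp only [level] at h
  unfold Prec
  rcases lt_trichotomy D.root E.root with hr | hr | hr
  · have hl : E.path.length + 1 ≤ D.path.length := by omega
    have := Nat.pow_le_pow_right (n := 2) (by norm_num) hl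
    rw [pow_succ] at this
    constructor
    · rintro (h' | h') <;> omega
    · intro h'; omega
  · have hl : D.path.length = E.path.length := by omega
    simp [hr, lex_iff_appendBits_lt D.path E.path 1 hl, code]
  · have hl : D.path.length + 1 ≤ E.path.length := by omega
    have := Nat.pow_le_pow_right (n := 2) (by norm_num) hl
    rw [pow_succ] at this
    constructor
    · intro _; omega
    · intro _; exact Or.inl hr

theorem eq_of_code_eq {D E : DerivedBrick} (h : D.level = E.level) (hc : D.code = E.code) :
    D = E := by
  have hD := D.code_bounds
  have hE := E.code_bounds
  have hl : D.path.length = E.path.length := by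
    rcases lt_trichotomy D.path.length E.path.length with hr | hr | hr
    · have := Nat.pow_le_pow_right (n := 2) (by norm_num) (Nat.succ_le_of_lt hr)
      rw [Nat.succ_eq_add_one, pow_succ] at this
      omega
    · exact hr
    · have := Nat.pow_le_pow_right (n := 2) (by norm_num) (Nat.succ_le_of_lt hr)
      rw [Nat.succ_eq_add_one, pow_succ] at this
      omega
  simp only [level] at h
  ext1
  · omega
  · exact appendBits_injective _ _ 1 hl hc

theorem exists_code_eq (k : ℤ) {n : ℕ} (hn : 1 ≤ n) :
    ∃ D : DerivedBrick, D.level = k ∧ D.code = n := by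
  obtain ⟨l, hl⟩ := exists_appendBits n hn
  exact ⟨⟨k - l.length, l⟩, by simp [level], hl⟩

/-- At a fixed level, a smaller code means a root at least as large. -/
theorem root_le_of_code_lt {D E : DerivedBrick} (h : E.level = D.level) (hc : E.code < D.code) :
    D.root ≤ E.root := by
  rcases (prec_iff_code_lt h).2 hc with h' | h'
  · exact h'.le
  · exact h'.1.ge

/-- `E` arises from `D` by splitting, so that `E` lies within `D`. -/
def Refines (E D : DerivedBrick) : Prop := E.root = D.root ∧ D.path <+: E.path

/-- One of the two bricks lies within the other. -/
def Comparable (D E : DerivedBrick) : Prop := D.Refines E ∨ E.Refines D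

theorem Comparable.symm {D E : DerivedBrick} (h : D.Comparable E) : E.Comparable D := Or.symm h

theorem Comparable.root_eq {D E : DerivedBrick} (h : D.Comparable E) : D.root = E.root := by
  rcases h with h | h
  · exact h.1
  · exact h.1.symm

theorem Refines.code_div {E D : DerivedBrick} (h : E.Refines D) :
    ∃ n : ℕ, E.level = D.level + n ∧ E.code / 2 ^ n = D.code := by
  obtain ⟨hr, l, hl⟩ := h
  refine ⟨l.length, ?_, ?_⟩
  · simp only [level, hr, ← hl, List.length_append]
    push_cast
    ring
  · rw [code, ← hl, appendBits_append, appendBits_div, code]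

end DerivedBrick

/-! ### Geometry of bricks -/

theorem sqrt_two_zpow_add_two (k : ℤ) : √2 ^ (k + 2) = 2 * √2 ^ k := by
  rw [zpow_add₀ (by positivity)]
  have : √2 ^ (2 : ℤ) = 2 := by
    rw [show (2 : ℤ) = ((2 : ℕ) : ℤ) by norm_num, zpow_natCast]
    exact Real.sq_sqrt (by norm_num)
  rw [this]; ring

theorem brickWidth_pos (k : ℤ) : 0 < brickWidth k := by
  unfold brickWidth; split_ifs <;> positivity

theorem brickHeight_pos (k : ℤ) : 0 < brickHeight k := by
  unfold brickHeight; split_ifs <;> positivity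

theorem brickWidth_succ_of_even {k : ℤ} (h : Even k) : brickWidth k = 2 * brickWidth (k + 1) := by
  have h' : ¬ Even (k + 1) := by rwa [Int.even_add_one, not_not]
  simp only [brickWidth, h, h', if_true, if_false]
  rw [← sqrt_two_zpow_add_two]; congr 1; ring

theorem brickHeight_succ_of_even {k : ℤ} (h : Even k) : brickHeight (k + 1) = brickHeight k := by
  have h' : ¬ Even (k + 1) := by rwa [Int.even_add_one, not_not]
  simp only [brickHeight, h, h', if_true, if_false]
  congr 1; ring

theorem brickWidth_succ_of_not_even {k : ℤ} (h : ¬ Even k) :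
    brickWidth (k + 1) = brickWidth k := by
  have h' : Even (k + 1) := by rwa [Int.even_add_one]
  simp only [brickWidth, h, h', if_true, if_false]
  congr 1; ring

theorem brickHeight_succ_of_not_even {k : ℤ} (h : ¬ Even k) :
    brickHeight k = 2 * brickHeight (k + 1) := by
  have h' : Even (k + 1) := by rwa [Int.even_add_one]
  simp only [brickHeight, h, h', if_true, if_false]
  rw [← sqrt_two_zpow_add_two]; congr 1; ring

theorem interior_rectangle (q : ℝ × ℝ) (w h : ℝ) :
    interior (rectangle q w h) = Ioo q.1 (q.1 + w) ×ˢ Ioo q.2 (q.2 + h) := by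
  rw [rectangle, interior_prod_eq, interior_Icc, interior_Icc]

theorem rectangle_subset {q r : ℝ × ℝ} {w h w' h' : ℝ} (h1 : r.1 ≤ q.1)
    (h2 : q.1 + w ≤ r.1 + w') (h3 : r.2 ≤ q.2) (h4 : q.2 + h ≤ r.2 + h') :
    rectangle q w h ⊆ rectangle r w' h' :=
  prod_mono (Icc_subset_Icc h1 h2) (Icc_subset_Icc h3 h4)

theorem interiorDisjoint_of_left {q r : ℝ × ℝ} {w h w' h' : ℝ} (h1 : q.1 + w ≤ r.1) :
    InteriorDisjoint (rectangle q w h) (rectangle r w' h') := by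
  rw [InteriorDisjoint, interior_rectangle, interior_rectangle, Set.disjoint_left]
  rintro p ⟨⟨_, h2⟩, _⟩ ⟨⟨h3, _⟩, _⟩
  linarith

theorem interiorDisjoint_of_below {q r : ℝ × ℝ} {w h w' h' : ℝ} (h1 : q.2 + h ≤ r.2) :
    InteriorDisjoint (rectangle q w h) (rectangle r w' h') := by
  rw [InteriorDisjoint, interior_rectangle, interior_rectangle, Set.disjoint_left]
  rintro p ⟨_, ⟨_, h2⟩⟩ ⟨_, ⟨h3, _⟩⟩
  linarith

theorem InteriorDisjoint.symm {S T : Set (ℝ × ℝ)} (h : InteriorDisjoint S T) :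
    InteriorDisjoint T S := Disjoint.symm h

theorem InteriorDisjoint.mono {S T S' T' : Set (ℝ × ℝ)} (h : InteriorDisjoint S T)
    (hS : S' ⊆ S) (hT : T' ⊆ T) : InteriorDisjoint S' T' :=
  Disjoint.mono (interior_mono hS) (interior_mono hT) h

namespace Brick

/-- The brick `B'` lies within the brick `B`, in terms of the coordinates of their sides. -/
structure Within (B' B : Brick) : Prop where
  left : B.corner.1 ≤ B'.corner.1
  right : B'.corner.1 + brickWidth B'.level ≤ B.corner.1 + brickWidth B.level
  bottom : B.corner.2 ≤ B'.corner.2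
  top : B'.corner.2 + brickHeight B'.level ≤ B.corner.2 + brickHeight B.level

theorem Within.refl (B : Brick) : B.Within B := ⟨le_rfl, le_rfl, le_rfl, le_rfl⟩

theorem Within.trans {B C D : Brick} (h : B.Within C) (h' : C.Within D) : B.Within D :=
  ⟨h'.left.trans h.left, h.right.trans h'.right, h'.bottom.trans h.bottom, h.top.trans h'.top⟩

theorem Within.region_subset {B C : Brick} (h : B.Within C) : B.region ⊆ C.region :=
  rectangle_subset h.left h.right h.bottom h.top

theorem split_within (B : Brick) (b : Bool) : (B.split b).Within B := by
  have hw := brickWidth_pos (B.level + 1)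
  have hh := brickHeight_pos (B.level + 1)
  by_cases he : Even B.level
  · have h1 := brickWidth_succ_of_even he
    have h2 := brickHeight_succ_of_even he
    cases b <;> constructor <;> simp [split, he] <;> linarith
  · have h1 := brickWidth_succ_of_not_even he
    have h2 := brickHeight_succ_of_not_even he
    cases b <;> constructor <;> simp [split, he] <;> linarith

theorem foldl_split_within (l : List Bool) : ∀ B : Brick, (l.foldl split B).Within B := by
  induction l with
  | nil => exact Within.refl
  | cons b l ih => exact fun B => (ih _).trans (B.split_within b)

theorem split_interiorDisjoint (B : Brick) :
    InteriorDisjoint (B.split false).region (B.split true).region := by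
  by_cases he : Even B.level
  · apply interiorDisjoint_of_left
    simp [split, he]
  · apply interiorDisjoint_of_below
    simp [split, he]

theorem interior_region_nonempty (B : Brick) : (interior B.region).Nonempty := by
  rw [region, interior_rectangle]
  have hw := brickWidth_pos B.level
  have hh := brickHeight_pos B.level
  exact (nonempty_Ioo.2 (by linarith)).prod (nonempty_Ioo.2 (by linarith))

end Brick

/-- All fundamental bricks of index larger than `i` lie to the left of `B_i` or below it. -/
theorem fundamentalBrick_interiorDisjoint {i j : ℤ} (h : i < j) :
    InteriorDisjoint (fundamentalBrick j).region (fundamentalBrick i).region := by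
  have hmono : ∀ {a b : ℤ}, a ≤ b → √2 ^ a ≤ √2 ^ b := fun h =>
    zpow_le_zpow_right₀ (by rw [Real.one_le_sqrt]; norm_num) h
  by_cases hi : Even i
  · apply interiorDisjoint_of_below
    by_cases hj : Even j
    · have hij : i + 2 ≤ j := by
        obtain ⟨a, rfl⟩ := hi; obtain ⟨b, rfl⟩ := hj; omega
      simp only [fundamentalBrick, brickHeight, hi, hj, if_true]
      have := sqrt_two_zpow_add_two (-j - 1)
      have := hmono (show -j - 1 + 2 ≤ -i - 1 by omega)
      linarith
    · simp only [fundamentalBrick, brickHeight, hi, hj, if_true, if_false]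
      have := hmono (show -j ≤ -i - 1 by omega)
      linarith
  · apply interiorDisjoint_of_left
    by_cases hj : Even j
    · simp only [fundamentalBrick, brickWidth, hi, hj, if_true, if_false]
      have := hmono (show -j ≤ -i - 1 by omega)
      linarith
    · have hij : i + 2 ≤ j := by
        rw [Int.not_even_iff_odd] at hi hj
        obtain ⟨a, rfl⟩ := hi; obtain ⟨b, rfl⟩ := hj; omega
      simp only [fundamentalBrick, brickWidth, hi, hj, if_false]
      have := sqrt_two_zpow_add_two (-j - 1)
      have := hmono (show -j - 1 + 2 ≤ -i - 1 by omega)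
      linarith

namespace DerivedBrick

theorem Refines.within {E D : DerivedBrick} (h : E.Refines D) : E.toBrick.Within D.toBrick := by
  obtain ⟨hr, l, hl⟩ := h
  rw [toBrick, toBrick, ← hl, hr, List.foldl_append]
  exact Brick.foldl_split_within l _

theorem region_subset_fundamentalBrick (D : DerivedBrick) :
    D.region ⊆ (fundamentalBrick D.root).region :=
  (Brick.foldl_split_within D.path _).region_subset

theorem foldl_split_interiorDisjoint : ∀ (l l' : List Bool) (B : Brick), ¬ l <+: l' → ¬ l' <+: l →
    InteriorDisjoint (l.foldl Brick.split B).region (l'.foldl Brick.split B).region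
  | [], _, _, h, _ => absurd (List.nil_prefix) h
  | _ :: _, [], _, _, h => absurd (List.nil_prefix) h
  | b :: l, b' :: l', B, h, h' => by
    by_cases hb : b = b'
    · subst hb
      exact foldl_split_interiorDisjoint l l' _ (by simpa using h) (by simpa using h')
    · have key : InteriorDisjoint (B.split b).region (B.split b').region := by
        cases b <;> cases b'
        · exact absurd rfl hb
        · exact B.split_interiorDisjoint
        · exact B.split_interiorDisjoint.symm
        · exact absurd rfl hb
      exact key.mono (Brick.foldl_split_within l _).region_subset
        (Brick.foldl_split_within l' _).region_subset

theorem interiorDisjoint_of_not_comparable {D E : DerivedBrick} (h : ¬ D.Comparable E) :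
    InteriorDisjoint D.region E.region := by
  rcases lt_trichotomy D.root E.root with hr | hr | hr
  · exact (fundamentalBrick_interiorDisjoint hr).symm.mono D.region_subset_fundamentalBrick
      E.region_subset_fundamentalBrick
  · simp only [Comparable, Refines, not_or, not_and] at h
    rw [region, region, toBrick, toBrick, hr]
    exact foldl_split_interiorDisjoint _ _ _ (h.2 hr.symm) (h.1 hr)
  · exact (fundamentalBrick_interiorDisjoint hr).mono D.region_subset_fundamentalBrick
      E.region_subset_fundamentalBrick

theorem Comparable.not_interiorDisjoint {D E : DerivedBrick} (h : D.Comparable E) :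
    ¬ InteriorDisjoint D.region E.region := by
  have key : ∀ {D E : DerivedBrick}, D.Refines E → ¬ InteriorDisjoint D.region E.region := by
    intro D E h hd
    obtain ⟨p, hp⟩ := D.toBrick.interior_region_nonempty
    exact Set.disjoint_left.1 hd hp (interior_mono h.within.region_subset hp)
  rcases h with h | h
  · exact key h
  · exact fun hd => key h hd.symm

theorem interiorDisjoint_iff {D E : DerivedBrick} :
    InteriorDisjoint D.region E.region ↔ ¬ D.Comparable E :=
  ⟨fun h hc => hc.not_interiorDisjoint h, interiorDisjoint_of_not_comparable⟩

end DerivedBrick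

/-! ### First-fit families of dyadic intervals -/

namespace Dyadic

/-- A pair `(m, n)` stands for the dyadic interval `[n / 2 ^ m, (n + 1) / 2 ^ m)`. Two such
intervals meet if and only if one of them contains the other. -/
def Meets (a b : ℕ × ℕ) : Prop :=
  (a.1 ≤ b.1 ∧ b.2 / 2 ^ (b.1 - a.1) = a.2) ∨ (b.1 ≤ a.1 ∧ a.2 / 2 ^ (a.1 - b.1) = b.2)

/-- A family of dyadic intervals is first-fit if every interval that precedes a member of the same
length meets some member. The interval `[0, 1 / 2 ^ m)` is exempt. -/
def FirstFit (F : Finset (ℕ × ℕ)) : Prop :=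
  ∀ D ∈ F, ∀ n, 1 ≤ n → n < D.2 → ∃ E ∈ F, Meets (D.1, n) E

/-- The dyadic intervals of length `1 / 2 ^ M` to the left of `x / 2 ^ M` that lie in a member of
`F`, where `M` is at least the level of every member. -/
def covered (F : Finset (ℕ × ℕ)) (M x : ℕ) : Finset ℕ :=
  (Finset.range x).filter fun c => ∃ D ∈ F, c / 2 ^ (M - D.1) = D.2

theorem covered_mono (F : Finset (ℕ × ℕ)) (M : ℕ) {x y : ℕ} (h : x ≤ y) :
    covered F M x ⊆ covered F M y :=
  Finset.filter_subset_filter _ (Finset.range_subset_range.2 h)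

theorem div_pow_div_pow (c : ℕ) {a b : ℕ} (h : a ≤ b) : c / 2 ^ a / 2 ^ (b - a) = c / 2 ^ b := by
  rw [Nat.div_div_eq_div_mul, ← pow_add, Nat.add_sub_cancel' h]

/-- If a member of a first-fit family lies in the interval `n₀` of level `m₀`, then everything
up to the right end of that interval is covered, except for a set of measure `1 / 2 ^ m₀`. Indeed,
each earlier interval of level `m₀` is either covered by a single member or contains a shorter
one, and the last interval of the second kind is treated by the same statement for level
`m₀ + 1`. -/
theorem FirstFit.le_card_covered {F : Finset (ℕ × ℕ)} (hF : FirstFit F) {M : ℕ}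
    (hM : ∀ D ∈ F, D.1 ≤ M) : ∀ d m₀, m₀ + d = M → ∀ D ∈ F, m₀ ≤ D.1 →
      D.2 / 2 ^ (D.1 - m₀) * 2 ^ d ≤ (covered F M ((D.2 / 2 ^ (D.1 - m₀) + 1) * 2 ^ d)).card := by
  intro d
  induction d with
  | zero =>
    intro m₀ hm D hD hmD
    have hDM : D.1 = M := le_antisymm (hM D hD) (by omega)
    have h0 : D.1 - m₀ = 0 := by omega
    simp only [h0, pow_zero, Nat.div_one, mul_one]
    have hsub : Finset.Icc 1 D.2 ⊆ covered F M (D.2 + 1) := by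
      intro c hc
      rw [Finset.mem_Icc] at hc
      refine Finset.mem_filter.2 ⟨Finset.mem_range.2 (by omega), ?_⟩
      rcases hc.2.lt_or_eq with h | h
      · obtain ⟨E, hE, hmeet⟩ := hF D hD c hc.1 h
        refine ⟨E, hE, ?_⟩
        rcases hmeet with ⟨h1, h2⟩ | ⟨h1, h2⟩
        · have h3 := hM E hE
          simp only at h1 h2
          rw [show E.1 - D.1 = 0 by omega, pow_zero, Nat.div_one] at h2
          rw [show M - E.1 = 0 by omega, pow_zero, Nat.div_one, h2]
        · simpa [hDM] using h2
      · exact ⟨D, hD, by rw [show M - D.1 = 0 by omega, pow_zero, Nat.div_one, h]⟩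
    simpa using Finset.card_le_card hsub
  | succ d ih =>
    intro m₀ hm D hD hmD
    set n₀ := D.2 / 2 ^ (D.1 - m₀) with hn₀
    suffices h : ∀ n ≤ n₀, n * 2 ^ (d + 1) ≤ (covered F M ((n + 1) * 2 ^ (d + 1))).card from
      h n₀ le_rfl
    intro n
    induction n with
    | zero => intro _; simp
    | succ n ihn =>
      intro hn
      by_cases hsub : ∃ E ∈ F, m₀ + 1 ≤ E.1 ∧ E.2 / 2 ^ (E.1 - m₀) = n + 1
      · obtain ⟨E, hE, hmE, hEn⟩ := hsub
        have key := ih (m₀ + 1) (by omega) E hE hmE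
        set n₁ := E.2 / 2 ^ (E.1 - (m₀ + 1)) with hn₁
        have hhalf : n₁ / 2 = n + 1 := by
          rw [hn₁, Nat.div_div_eq_div_mul, ← pow_succ,
            show E.1 - (m₀ + 1) + 1 = E.1 - m₀ by omega, hEn]
        have h1 : (n + 1) * 2 ^ (d + 1) ≤ n₁ * 2 ^ d := by
          rw [pow_succ, mul_comm (2 ^ d) 2, ← mul_assoc]
          exact Nat.mul_le_mul_right _ (by omega)
        have h2 : (n₁ + 1) * 2 ^ d ≤ (n + 1 + 1) * 2 ^ (d + 1) := by
          rw [pow_succ, mul_comm (2 ^ d) 2, ← mul_assoc]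
          exact Nat.mul_le_mul_right _ (by omega)
        exact h1.trans (key.trans (Finset.card_le_card (covered_mono F M h2)))
      · -- No shorter member lies in interval `n + 1`, so a single member contains it.
        have hcov : ∃ E ∈ F, E.1 ≤ m₀ ∧ (n + 1) / 2 ^ (m₀ - E.1) = E.2 := by
          push Not at hsub
          rcases hn.lt_or_eq with hlt | heq
          · have hpos : 0 < 2 ^ (D.1 - m₀) := by positivity
            have hlt' : (n + 1) * 2 ^ (D.1 - m₀) < D.2 := by
              have h1 : (n + 1 + 1) * 2 ^ (D.1 - m₀) ≤ n₀ * 2 ^ (D.1 - m₀) :=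
                Nat.mul_le_mul_right _ hlt
              have h2 : n₀ * 2 ^ (D.1 - m₀) ≤ D.2 := Nat.div_mul_le_self _ _
              nlinarith
            obtain ⟨E, hE, hmeet⟩ := hF D hD _ (Nat.mul_pos (Nat.succ_pos n) hpos) hlt'
            rcases hmeet with ⟨h1, h2⟩ | ⟨h1, h2⟩
            · simp only at h1 h2
              by_cases hmE : m₀ + 1 ≤ E.1
              · refine absurd ?_ (hsub E hE hmE)
                rw [← div_pow_div_pow E.2 (show E.1 - D.1 ≤ E.1 - m₀ by omega), h2,
                  show E.1 - m₀ - (E.1 - D.1) = D.1 - m₀ by omega, Nat.mul_div_cancel _ hpos]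
              · refine ⟨E, hE, by omega, ?_⟩
                rw [show E.1 - D.1 = 0 by omega, show D.1 - m₀ = 0 by omega] at h2
                rw [show m₀ - E.1 = 0 by omega]
                simpa using h2.symm
            · simp only at h1 h2
              by_cases hmE : m₀ + 1 ≤ E.1
              · refine absurd ?_ (hsub E hE hmE)
                rw [← h2, Nat.div_div_eq_div_mul, ← pow_add,
                  show D.1 - E.1 + (E.1 - m₀) = D.1 - m₀ by omega, Nat.mul_div_cancel _ hpos]
              · refine ⟨E, hE, by omega, ?_⟩
                rw [← h2, ← div_pow_div_pow _ (show D.1 - m₀ ≤ D.1 - E.1 by omega),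
                  Nat.mul_div_cancel _ hpos, show D.1 - E.1 - (D.1 - m₀) = m₀ - E.1 by omega]
          · have hDm : D.1 = m₀ := by
              by_contra hne
              exact hsub D hD (by omega) heq.symm
            refine ⟨D, hD, hDm.le, ?_⟩
            rw [hn₀, hDm] at heq
            rw [heq, hDm]
            simp
        obtain ⟨E, hE, hEm, hEn⟩ := hcov
        have hsubset : covered F M ((n + 1) * 2 ^ (d + 1)) ∪
            Finset.Ico ((n + 1) * 2 ^ (d + 1)) ((n + 1 + 1) * 2 ^ (d + 1)) ⊆
            covered F M ((n + 1 + 1) * 2 ^ (d + 1)) := by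
          apply Finset.union_subset
          · exact covered_mono F M (Nat.mul_le_mul_right _ (by omega))
          · intro c hc
            rw [Finset.mem_Ico] at hc
            refine Finset.mem_filter.2 ⟨Finset.mem_range.2 hc.2, E, hE, ?_⟩
            rw [← div_pow_div_pow c (show d + 1 ≤ M - E.1 by omega),
              Nat.div_eq_of_lt_le hc.1 hc.2, show M - E.1 - (d + 1) = m₀ - E.1 by omega, hEn]
        have hdisj : Disjoint (covered F M ((n + 1) * 2 ^ (d + 1)))
            (Finset.Ico ((n + 1) * 2 ^ (d + 1)) ((n + 1 + 1) * 2 ^ (d + 1))) := by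
          rw [Finset.disjoint_left]
          intro c hc hc'
          have h1 := Finset.mem_range.1 (Finset.mem_filter.1 hc).1
          have h2 := (Finset.mem_Ico.1 hc').1
          omega
        have hcard := Finset.card_le_card hsubset
        rw [Finset.card_union_of_disjoint hdisj, Nat.card_Ico] at hcard
        have hthis := ihn (by omega)
        have e1 : (n + 1 + 1) * 2 ^ (d + 1) = (n + 1) * 2 ^ (d + 1) + 2 ^ (d + 1) := by ring
        have e2 : (n + 1) * 2 ^ (d + 1) = n * 2 ^ (d + 1) + 2 ^ (d + 1) := by ring
        omega

/-- If a member of a first-fit family lies in the interval `n₀` of level `m₀`, then the members that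
begin to the left of the right end of that interval have total length at least `n₀ / 2 ^ m₀`. -/
theorem FirstFit.le_sum {F : Finset (ℕ × ℕ)} (hF : FirstFit F) {D : ℕ × ℕ} (hD : D ∈ F)
    {m₀ n₀ : ℕ} (hm : m₀ ≤ D.1) (hn : D.2 / 2 ^ (D.1 - m₀) = n₀) :
    (n₀ : ℝ) / 2 ^ m₀ ≤
      ∑ E ∈ F with E.2 * 2 ^ m₀ < (n₀ + 1) * 2 ^ E.1, (1 / 2 : ℝ) ^ E.1 := by
  obtain ⟨M, hM⟩ : ∃ M, ∀ E ∈ F, E.1 ≤ M :=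
    ⟨F.sup Prod.fst, fun E hE => Finset.le_sup (f := Prod.fst) hE⟩
  have hmM : m₀ ≤ M := hm.trans (hM D hD)
  have h1 := hF.le_card_covered hM (M - m₀) m₀ (by omega) D hD hm
  rw [hn] at h1
  set G := F.filter fun E => E.2 * 2 ^ m₀ < (n₀ + 1) * 2 ^ E.1 with hG
  have h2 : covered F M ((n₀ + 1) * 2 ^ (M - m₀)) ⊆
      G.biUnion fun E => Finset.Ico (E.2 * 2 ^ (M - E.1)) ((E.2 + 1) * 2 ^ (M - E.1)) := by
    intro c hc
    obtain ⟨hc, E, hE, hcE⟩ := Finset.mem_filter.1 hc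
    rw [Finset.mem_range] at hc
    have hpos : 0 < 2 ^ (M - E.1) := by positivity
    have h3 : E.2 * 2 ^ (M - E.1) ≤ c := by rw [← hcE]; exact Nat.div_mul_le_self _ _
    have h4 : c < (E.2 + 1) * 2 ^ (M - E.1) := by
      rw [← hcE, add_mul, one_mul]; exact Nat.lt_div_mul_add hpos
    refine Finset.mem_biUnion.2 ⟨E, Finset.mem_filter.2 ⟨hE, ?_⟩, Finset.mem_Ico.2 ⟨h3, h4⟩⟩
    have h5 : E.2 * 2 ^ (M - E.1) < (n₀ + 1) * 2 ^ (M - m₀) := h3.trans_lt hc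
    have h6 := Nat.mul_lt_mul_of_pos_right h5 (show 0 < 2 ^ (m₀ + E.1) by positivity)
    have hEM := hM E hE
    have e1 : E.2 * 2 ^ (M - E.1) * 2 ^ (m₀ + E.1) = E.2 * 2 ^ m₀ * 2 ^ M := by
      rw [mul_assoc, ← pow_add, mul_assoc, ← pow_add]; congr 2; omega
    have e2 : (n₀ + 1) * 2 ^ (M - m₀) * 2 ^ (m₀ + E.1) = (n₀ + 1) * 2 ^ E.1 * 2 ^ M := by
      rw [mul_assoc, ← pow_add, mul_assoc, ← pow_add]; congr 2; omega
    rw [e1, e2] at h6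
    exact Nat.lt_of_mul_lt_mul_right h6
  have h3 : n₀ * 2 ^ (M - m₀) ≤ ∑ E ∈ G, 2 ^ (M - E.1) := by
    refine h1.trans ((Finset.card_le_card h2).trans (Finset.card_biUnion_le.trans ?_))
    refine Finset.sum_le_sum fun E _ => ?_
    rw [Nat.card_Ico, add_mul, one_mul, Nat.add_sub_cancel_left]
  have h4 : (n₀ : ℝ) * 2 ^ (M - m₀) ≤ ∑ E ∈ G, (2 : ℝ) ^ (M - E.1) := by exact_mod_cast h3
  have h5 : ∀ m, m ≤ M → (2 : ℝ) ^ (M - m) = 2 ^ M * (1 / 2) ^ m := by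
    intro m hm
    rw [pow_sub₀ _ two_ne_zero hm, one_div, inv_pow]
  rw [h5 m₀ hmM, Finset.sum_congr rfl fun E hE => h5 E.1 (hM E (Finset.mem_filter.1 hE).1),
    ← Finset.mul_sum] at h4
  have h6 : (0 : ℝ) < 2 ^ M := by positivity
  rw [show (n₀ : ℝ) * (2 ^ M * (1 / 2) ^ m₀) = 2 ^ M * (n₀ / 2 ^ m₀) by
    rw [one_div, inv_pow]; ring] at h4
  exact le_of_mul_le_mul_left h4 h6

end Dyadic

/-! ### Suitable levels -/

theorem exists_suitable (p : Piece) : ∃ k : ℤ, Suitable k p := by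
  set fits : ℤ → Prop := fun k => p.width ≤ brickWidth k ∧ p.height ≤ brickHeight k with hfits
  have hone : (1 : ℝ) < √2 := by rw [Real.lt_sqrt] <;> norm_num
  have hanti : Antitone fun k : ℤ => √2 ^ (-k) := fun a b hab =>
    zpow_le_zpow_right₀ hone.le (neg_le_neg hab)
  obtain ⟨n, hn⟩ := pow_unbounded_of_one_lt (max p.width p.height) hone
  obtain ⟨m, hm⟩ := exists_pow_lt_of_lt_one p.width_pos
    (show (√2)⁻¹ < 1 from inv_lt_one_of_one_lt₀ hone)
  have hbound : ∀ z : ℤ, fits z → z ≤ m := by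
    intro z hz
    by_contra! hlt
    have h1 : brickWidth z ≤ √2 ^ (-z) := by
      unfold brickWidth
      split_ifs
      · exact le_rfl
      · exact zpow_le_zpow_right₀ hone.le (by omega)
    have h2 : √2 ^ (-z) ≤ (√2)⁻¹ ^ m := by
      rw [inv_pow, ← zpow_natCast, ← zpow_neg]
      exact hanti hlt.le
    linarith [hz.1]
  have hex : fits (-(n : ℤ) - 1) := by
    have h0 : √2 ^ (n : ℤ) = √2 ^ n := zpow_natCast _ _
    have h1 : √2 ^ n ≤ brickWidth (-(n : ℤ) - 1) := by
      rw [← h0]; unfold brickWidth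
      split_ifs <;> exact zpow_le_zpow_right₀ hone.le (by omega)
    have h2 : √2 ^ n ≤ brickHeight (-(n : ℤ) - 1) := by
      rw [← h0]; unfold brickHeight
      split_ifs <;> exact zpow_le_zpow_right₀ hone.le (by omega)
    exact ⟨((le_max_left _ _).trans hn.le).trans h1, ((le_max_right _ _).trans hn.le).trans h2⟩
  obtain ⟨k, hk, hmax⟩ := Int.exists_greatest_of_bdd ⟨m, hbound⟩ ⟨_, hex⟩
  exact ⟨k, hk, fun h => by have := hmax _ h; omega⟩

theorem Suitable.width_gt {k : ℤ} {p : Piece} (h : Suitable k p) (hk : Even k) :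
    brickWidth k < 2 * p.width := by
  by_contra! hlt
  refine h.2 ⟨?_, ?_⟩
  · linarith [brickWidth_succ_of_even hk]
  · rw [brickHeight_succ_of_even hk]; exact h.1.2

theorem Suitable.height_gt {k : ℤ} {p : Piece} (h : Suitable k p) (hk : ¬ Even k) :
    brickHeight k < 2 * p.height := by
  by_contra! hlt
  refine h.2 ⟨?_, ?_⟩
  · rw [brickWidth_succ_of_not_even hk]; exact h.1.1
  · linarith [brickHeight_succ_of_not_even hk]

/-! ### The next piece can always be packed -/

namespace State

theorem finite_bricks (S : State) : S.bricks.Finite := by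
  have : S.bricks = (fun e : PackedPiece => e.brick) '' {e | e ∈ S} := rfl
  rw [this]
  exact (List.finite_toSet S).image _

theorem free_iff {S : State} {D : DerivedBrick} :
    S.Free D ↔ ∀ E ∈ S.bricks, ¬ D.Comparable E := by
  simp only [Free, DerivedBrick.interiorDisjoint_iff]

/-- A free `k`-brick is found in a fundamental brick larger than everything used so far. -/
theorem exists_free (S : State) (k : ℤ) : ∃ D : DerivedBrick, D.level = k ∧ S.Free D := by
  obtain ⟨b, hb⟩ := (S.finite_bricks.image DerivedBrick.root).bddBelow
  obtain ⟨m, hm1, hm2⟩ : ∃ m : ℤ, m < b ∧ m ≤ k := ⟨min (b - 1) k, by omega, by omega⟩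
  refine ⟨⟨m, List.replicate (k - m).toNat false⟩, ?_, ?_⟩
  · simp [DerivedBrick.level]; omega
  · rw [free_iff]
    intro E hE hc
    have h1 := hc.root_eq
    have h2 := hb ⟨E, hE, rfl⟩
    simp only at h1
    omega

theorem exists_isMinFree (S : State) (k : ℤ) : ∃ D : DerivedBrick, S.IsMinFree k D := by
  have hne : {D : DerivedBrick | D.level = k ∧ S.Free D}.Nonempty := S.exists_free k
  obtain ⟨D, hD, hmin⟩ := WellFounded.has_min (measure DerivedBrick.code).wf _ hne
  refine ⟨D, hD.1, hD.2, fun E hE hEf hne => ?_⟩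
  rw [DerivedBrick.prec_iff_code_lt (hD.1.trans hE.symm)]
  have h1 : ¬ E.code < D.code := hmin E ⟨hE, hEf⟩
  refine lt_of_le_of_ne (not_lt.1 h1) fun h => hne ?_
  exact DerivedBrick.eq_of_code_eq (hE.trans hD.1.symm) h.symm

theorem exists_chooses (S : State) (p : Piece) : ∃ D : DerivedBrick, S.Chooses p D := by
  obtain ⟨k, hk⟩ := exists_suitable p
  by_cases h : ∃ E ∈ S.bricks, E.level = k ∧ S.HasRoom E p
  · obtain ⟨E, hE, hEk, hr⟩ := h
    exact ⟨E, k, hk, Or.inl ⟨hE, hEk, hr⟩⟩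
  · obtain ⟨D, hD⟩ := S.exists_isMinFree k
    exact ⟨D, k, hk, Or.inr ⟨h, hD⟩⟩

/-! ### Invariants of the algorithm -/

/-- The total of `f` over the pieces packed in `D`. -/
noncomputable def fill (S : State) (f : Piece → ℝ) (D : DerivedBrick) : ℝ :=
  ((S.piecesIn D).map f).sum

open Classical in
theorem fill_append (S : State) (e : PackedPiece) (f : Piece → ℝ) (D : DerivedBrick) :
    State.fill (S ++ [e]) f D = S.fill f D + if e.brick = D then f e.piece else 0 := by
  unfold fill piecesIn
  split_ifs with h <;> simp [List.filter_append, h]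

theorem fill_nonneg (S : State) {f : Piece → ℝ} (hf : ∀ p, 0 < f p) (D : DerivedBrick) :
    0 ≤ S.fill f D := by
  apply List.sum_nonneg
  intro x hx
  obtain ⟨p, _, rfl⟩ := List.mem_map.1 hx
  exact (hf p).le

open Classical in
theorem fill_eq_zero {S : State} (f : Piece → ℝ) {D : DerivedBrick} (hD : D ∉ S.bricks) :
    S.fill f D = 0 := by
  have : (S.filter fun e => decide (e.brick = D)) = [] := by
    rw [List.filter_eq_nil_iff]
    intro e he h
    exact hD ⟨e, he, by simpa using h⟩
  unfold fill piecesIn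
  simp [this]

theorem mem_bricks_append {S : State} {e : PackedPiece} {D : DerivedBrick} :
    D ∈ State.bricks (S ++ [e]) ↔ D ∈ S.bricks ∨ D = e.brick := by
  simp only [bricks, mem_ofPred_eq, List.mem_append, List.mem_singleton]
  constructor
  · rintro ⟨e', h | h, rfl⟩
    · exact Or.inl ⟨e', h, rfl⟩
    · exact Or.inr (by rw [h])
  · rintro (⟨e', h, rfl⟩ | rfl)
    · exact ⟨e', Or.inl h, rfl⟩
    · exact ⟨e, Or.inr rfl, rfl⟩

/-- How pieces lie in the bricks whose level has the parity `P`. The functions `w`, `bw`, `cx`, `x`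
measure pieces, bricks, lower left corners of bricks and lower left corners of pieces across the
stacking direction, and `h`, `bh`, `cy`, `y` along it. -/
structure IsStacked (S : State) (P : ℤ → Prop) (bw bh : ℤ → ℝ) (cx cy : DerivedBrick → ℝ)
    (w h : Piece → ℝ) (x y : ℝ × ℝ → ℝ) : Prop where
  wide : ∀ e ∈ S, P e.brick.level → bw e.brick.level < 2 * w e.piece
  le : ∀ e ∈ S, P e.brick.level → w e.piece ≤ bw e.brick.level
  xpos : ∀ e ∈ S, P e.brick.level → x e.pos = cx e.brick
  ylow : ∀ e ∈ S, P e.brick.level → cy e.brick ≤ y e.pos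
  yhigh : ∀ e ∈ S, P e.brick.level → y e.pos + h e.piece ≤ cy e.brick + S.fill h e.brick
  fits : ∀ e ∈ S, P e.brick.level → S.fill h e.brick ≤ bh e.brick.level
  full : ∀ e ∈ S, ∀ e' ∈ S, P e.brick.level → e.brick ≠ e'.brick →
    e.brick.level = e'.brick.level → bh e.brick.level < S.fill h e.brick + S.fill h e'.brick

theorem IsStacked.append {S : State} {P : ℤ → Prop} {bw bh : ℤ → ℝ} {cx cy : DerivedBrick → ℝ}
    {w h : Piece → ℝ} {x y : ℝ × ℝ → ℝ} (hS : S.IsStacked P bw bh cx cy w h x y)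
    (hpos : ∀ p, 0 < h p) (e : PackedPiece)
    (he : P e.brick.level → bw e.brick.level < 2 * w e.piece ∧ w e.piece ≤ bw e.brick.level ∧
      x e.pos = cx e.brick ∧ y e.pos = cy e.brick + S.fill h e.brick ∧
      S.fill h e.brick + h e.piece ≤ bh e.brick.level ∧
      (e.brick ∉ S.bricks → ∀ E ∈ S.bricks, E.level = e.brick.level →
        bh e.brick.level < S.fill h E + h e.piece)) :
    State.IsStacked (S ++ [e]) P bw bh cx cy w h x y := by
  have hmono : ∀ D, S.fill h D ≤ State.fill (S ++ [e]) h D := by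
    intro D
    rw [fill_append]
    have := hpos e.piece
    split_ifs <;> linarith
  have hself : State.fill (S ++ [e]) h e.brick = S.fill h e.brick + h e.piece := by
    rw [fill_append, if_pos rfl]
  have hother : ∀ D, e.brick ≠ D → State.fill (S ++ [e]) h D = S.fill h D := by
    intro D hD
    rw [fill_append, if_neg hD, add_zero]
  have hcase : ∀ e', e' ∈ S ++ [e] → e' ∈ S ∨ e' = e := by
    intro e' h'; simpa using h'
  have hnew : ∀ e' ∈ S, P e.brick.level → e'.brick ≠ e.brick →
      e'.brick.level = e.brick.level →
      bh e.brick.level < State.fill (S ++ [e]) h e'.brick + State.fill (S ++ [e]) h e.brick := by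
    intro e' he' hP hne hl
    by_cases hmem : e.brick ∈ S.bricks
    · obtain ⟨e'', he'', hb⟩ := hmem
      have h1 := hS.full e'' he'' e' he' (by rwa [hb]) (by rw [hb]; exact hne.symm) (by rw [hb, hl])
      rw [hb] at h1
      linarith [hmono e.brick, hmono e'.brick]
    · have h1 := (he hP).2.2.2.2.2 hmem e'.brick ⟨e', he', rfl⟩ hl
      rw [hself]
      linarith [hmono e'.brick, S.fill_nonneg hpos e.brick]
  constructor
  · intro e' he' hP
    rcases hcase e' he' with h' | rfl
    · exact hS.wide e' h' hP
    · exact (he hP).1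
  · intro e' he' hP
    rcases hcase e' he' with h' | rfl
    · exact hS.le e' h' hP
    · exact (he hP).2.1
  · intro e' he' hP
    rcases hcase e' he' with h' | rfl
    · exact hS.xpos e' h' hP
    · exact (he hP).2.2.1
  · intro e' he' hP
    rcases hcase e' he' with h' | rfl
    · exact hS.ylow e' h' hP
    · rw [(he hP).2.2.2.1]
      linarith [S.fill_nonneg hpos e'.brick]
  · intro e' he' hP
    rcases hcase e' he' with h' | rfl
    · exact (hS.yhigh e' h' hP).trans (by linarith [hmono e'.brick])
    · rw [(he hP).2.2.2.1, hself]
      linarith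
  · intro e' he' hP
    by_cases hb : e.brick = e'.brick
    · rw [← hb] at hP ⊢
      rw [hself]
      exact (he hP).2.2.2.2.1
    · rcases hcase e' he' with h' | rfl
      · rw [hother _ hb]
        exact hS.fits e' h' hP
      · exact absurd rfl hb
  · intro e₁ he₁ e₂ he₂ hP hne hl
    rcases hcase e₁ he₁ with h₁ | rfl
    · rcases hcase e₂ he₂ with h₂ | rfl
      · exact (hS.full e₁ h₁ e₂ h₂ hP hne hl).trans_le (add_le_add (hmono _) (hmono _))
      · rw [hl]
        exact hnew e₁ h₁ (by rwa [← hl]) hne hl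
    · rcases hcase e₂ he₂ with h₂ | rfl
      · rw [add_comm]
        exact hnew e₂ h₂ hP hne.symm hl.symm
      · exact absurd rfl hne

/-- The invariants of BrickTranslation on which the analysis rests. -/
structure Good (S : State) : Prop where
  even : S.IsStacked Even brickWidth brickHeight (fun D => D.toBrick.corner.1)
    (fun D => D.toBrick.corner.2) Piece.width Piece.height Prod.fst Prod.snd
  odd : S.IsStacked (fun k => ¬ Even k) brickHeight brickWidth (fun D => D.toBrick.corner.2)
    (fun D => D.toBrick.corner.1) Piece.height Piece.width Prod.snd Prod.fst
  eq_of_comparable : ∀ D ∈ S.bricks, ∀ E ∈ S.bricks, D.Comparable E → D = E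
  exists_comparable : ∀ D ∈ S.bricks, ∀ E : DerivedBrick, E.level = D.level → E.code < D.code →
    ∃ F ∈ S.bricks, E.Comparable F
  disjoint : S.Pairwise fun e e' => InteriorDisjoint e.region e'.region

theorem Good.region_subset {S : State} (hS : S.Good) {e : PackedPiece} (he : e ∈ S) :
    e.region ⊆ e.brick.region := by
  have hl := e.brick.toBrick_level
  by_cases hP : Even e.brick.level
  · have h1 := hS.even.le e he hP
    have h2 := hS.even.xpos e he hP
    have h3 := hS.even.ylow e he hP
    have h4 := hS.even.yhigh e he hP
    have h5 := hS.even.fits e he hP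
    apply rectangle_subset <;> (try rw [hl]) <;> linarith
  · have h1 := hS.odd.le e he hP
    have h2 := hS.odd.xpos e he hP
    have h3 := hS.odd.ylow e he hP
    have h4 := hS.odd.yhigh e he hP
    have h5 := hS.odd.fits e he hP
    apply rectangle_subset <;> (try rw [hl]) <;> linarith

theorem hasRoom_of_even {S : State} {D : DerivedBrick} {p : Piece} (hD : Even D.level)
    (hw : p.width ≤ brickWidth D.level)
    (hh : S.fill Piece.height D + p.height ≤ brickHeight D.level) : S.HasRoom D p := by
  have h0 := S.fill_nonneg Piece.height_pos D
  have hl := D.toBrick_level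
  simp only [fill] at h0 hh
  apply rectangle_subset <;> simp only [nextPos, hD, if_true, hl] <;> linarith

theorem hasRoom_of_not_even {S : State} {D : DerivedBrick} {p : Piece} (hD : ¬ Even D.level)
    (hw : p.height ≤ brickHeight D.level)
    (hh : S.fill Piece.width D + p.width ≤ brickWidth D.level) : S.HasRoom D p := by
  have h0 := S.fill_nonneg Piece.width_pos D
  have hl := D.toBrick_level
  simp only [fill] at h0 hh
  apply rectangle_subset <;> simp only [nextPos, hD, if_false, hl] <;> linarith

theorem HasRoom.le {S : State} {D : DerivedBrick} {p : Piece} (h : S.HasRoom D p) :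
    (S.nextPos D).1 + p.width ≤ D.toBrick.corner.1 + brickWidth D.level ∧
      (S.nextPos D).2 + p.height ≤ D.toBrick.corner.2 + brickHeight D.level := by
  have hmem : ((S.nextPos D).1 + p.width, (S.nextPos D).2 + p.height) ∈ D.region :=
    h ⟨⟨by simp [p.width_pos.le], le_rfl⟩, ⟨by simp [p.height_pos.le], le_rfl⟩⟩
  have hl := D.toBrick_level
  simp only [DerivedBrick.region, Brick.region, hl] at hmem
  exact ⟨hmem.1.2, hmem.2.2⟩

theorem Good.pack {S : State} (hS : S.Good) {p : Piece} {D : DerivedBrick}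
    (hD : S.Chooses p D) : (S.pack p D).Good := by
  obtain ⟨k, hk, hcase⟩ := hD
  have hlevel : D.level = k := by
    rcases hcase with h | h
    · exact h.2.1
    · exact h.2.1
  subst hlevel
  have hnotmem : D ∈ S.bricks ∨ D ∉ S.bricks ∧ S.Free D ∧
      (∀ E : DerivedBrick, E.level = D.level → E.code < D.code → ¬ S.Free E) ∧
      ∀ E ∈ S.bricks, E.level = D.level → ¬ S.HasRoom E p := by
    rcases hcase with h | ⟨h, h'⟩
    · exact Or.inl h.1
    · refine Or.inr ⟨fun hm => ?_, h'.2.1, fun E hE hc hf => ?_,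
        fun E hE hl hr => h ⟨E, hE, hl, hr⟩⟩
      · exact free_iff.1 h'.2.1 D hm (Or.inl ⟨rfl, List.prefix_rfl⟩)
      · have h1 := h'.2.2 E hE hf (by rintro rfl; exact lt_irrefl _ hc)
        rw [DerivedBrick.prec_iff_code_lt hE.symm] at h1
        omega
  have hroom : S.HasRoom D p := by
    rcases hcase with h | ⟨h, h'⟩
    · exact h.2.2
    · have hD : D ∉ S.bricks := fun hm =>
        free_iff.1 h'.2.1 D hm (Or.inl ⟨rfl, List.prefix_rfl⟩)
      by_cases hP : Even D.level
      · exact hasRoom_of_even hP hk.1.1 (by rw [fill_eq_zero _ hD, zero_add]; exact hk.1.2)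
      · exact hasRoom_of_not_even hP hk.1.2 (by rw [fill_eq_zero _ hD, zero_add]; exact hk.1.1)
  have heven : (S.pack p D).IsStacked Even brickWidth brickHeight (fun D => D.toBrick.corner.1)
      (fun D => D.toBrick.corner.2) Piece.width Piece.height Prod.fst Prod.snd := by
    refine hS.even.append Piece.height_pos _ fun hP => ?_
    simp only at hP ⊢
    have hy : (S.nextPos D).2 = D.toBrick.corner.2 + S.fill Piece.height D := by
      simp only [nextPos, hP, if_true, fill]
    refine ⟨hk.width_gt hP, hk.1.1, by simp [nextPos, hP], hy, ?_, fun hn E hE hl => ?_⟩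
    · linarith [hroom.le.2]
    · rcases hnotmem with h | h
      · exact absurd h hn
      · by_contra! hle
        refine h.2.2.2 E hE hl (hasRoom_of_even (by rwa [hl]) ?_ ?_)
        · rw [hl]; exact hk.1.1
        · rw [hl]; exact hle
  have hodd : (S.pack p D).IsStacked (fun k => ¬ Even k) brickHeight brickWidth
      (fun D => D.toBrick.corner.2) (fun D => D.toBrick.corner.1) Piece.height Piece.width
      Prod.snd Prod.fst := by
    refine hS.odd.append Piece.width_pos _ fun hP => ?_
    simp only at hP ⊢
    have hx : (S.nextPos D).1 = D.toBrick.corner.1 + S.fill Piece.width D := by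
      simp only [nextPos, hP, if_false, fill]
    refine ⟨hk.height_gt hP, hk.1.2, by simp [nextPos, hP], hx, ?_, fun hn E hE hl => ?_⟩
    · linarith [hroom.le.1]
    · rcases hnotmem with h | h
      · exact absurd h hn
      · by_contra! hle
        refine h.2.2.2 E hE hl (hasRoom_of_not_even (by rwa [hl]) ?_ ?_)
        · rw [hl]; exact hk.1.2
        · rw [hl]; exact hle
  refine ⟨heven, hodd, ?_, ?_, ?_⟩
  · intro E hE F hF hc
    rcases mem_bricks_append.1 hE with hE' | rfl <;>
      rcases mem_bricks_append.1 hF with hF' | rfl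
    · exact hS.eq_of_comparable E hE' F hF' hc
    · rcases hnotmem with h | h
      · exact hS.eq_of_comparable E hE' _ h hc
      · exact absurd hc.symm (free_iff.1 h.2.1 E hE')
    · rcases hnotmem with h | h
      · exact hS.eq_of_comparable _ h F hF' hc
      · exact absurd hc (free_iff.1 h.2.1 F hF')
    · rfl
  · intro E hE F hl hc
    have hold : E ∈ S.bricks → ∃ G ∈ (S.pack p D).bricks, F.Comparable G := by
      intro hE
      obtain ⟨G, hG, h⟩ := hS.exists_comparable E hE F hl hc
      exact ⟨G, mem_bricks_append.2 (Or.inl hG), h⟩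
    rcases mem_bricks_append.1 hE with hE | rfl
    · exact hold hE
    · rcases hnotmem with h | h
      · exact hold h
      · have h1 := h.2.2.1 F hl hc
        rw [free_iff] at h1
        push Not at h1
        obtain ⟨G, hG, h2⟩ := h1
        exact ⟨G, mem_bricks_append.2 (Or.inl hG), h2⟩
  · refine List.pairwise_append.2 ⟨hS.disjoint, List.pairwise_singleton _ _, ?_⟩
    intro e he e' he'
    rw [List.mem_singleton] at he'
    subst he'
    by_cases hb : e.brick = D
    · by_cases hP : Even D.level
      · apply interiorDisjoint_of_below
        have h1 := hS.even.yhigh e he (by rwa [hb])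
        simp only [nextPos, hP, if_true]
        rw [hb] at h1
        exact h1
      · apply interiorDisjoint_of_left
        have h1 := hS.odd.yhigh e he (by rwa [hb])
        simp only [nextPos, hP, if_false]
        rw [hb] at h1
        exact h1
    · have hdis : InteriorDisjoint e.brick.region D.region := by
        apply DerivedBrick.interiorDisjoint_of_not_comparable
        intro hc
        rcases hnotmem with h | h
        · exact hb (hS.eq_of_comparable _ ⟨e, he, rfl⟩ _ h hc)
        · exact free_iff.1 h.2.1 _ ⟨e, he, rfl⟩ hc.symm
      exact hdis.mono (hS.region_subset he) hroom

end State

theorem Run.good {L : List Piece} {S : State} (h : Run L S) : S.Good := by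
  induction h with
  | nil =>
    refine ⟨?_, ?_, ?_, ?_, List.Pairwise.nil⟩
    · constructor <;> simp
    · constructor <;> simp
    · rintro D ⟨e, he, _⟩; simp at he
    · rintro D ⟨e, he, _⟩; simp at he
  | step _ hD ih => exact ih.pack hD

theorem Run.map_piece {L : List Piece} {S : State} (h : Run L S) :
    S.map (fun e => e.piece) = L := by
  induction h with
  | nil => rfl
  | step _ _ ih => simp [State.pack, ih]

theorem Run.isPacking {L : List Piece} {S : State} (h : Run L S) :
    IsPacking L (S.map PackedPiece.toPlacedPiece) := by
  refine ⟨?_, ?_⟩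
  · rw [List.map_map, ← h.map_piece]; rfl
  · rw [List.pairwise_map]; exact h.good.disjoint

/-! ### Layouts and their symmetry -/

open Classical in
/-- The total of `f` over the pieces that are packed in the brick `D`. -/
noncomputable def total {ι : Type*} [Fintype ι] (b : ι → DerivedBrick) (f : ι → ℝ)
    (D : DerivedBrick) : ℝ := ∑ i with b i = D, f i

/-- The form of `State.IsStacked` for a family of pieces: piece `i` is packed in the brick `b i`,
has its lower left corner at `(x i, y i)` and size `w i × h i`, with the two coordinates exchanged
where bricks of odd level are concerned. -/
structure Stacked {ι : Type*} [Fintype ι] (P : ℤ → Prop) (bw bh : ℤ → ℝ)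
    (cx cy : DerivedBrick → ℝ) (b : ι → DerivedBrick) (w h x y : ι → ℝ) : Prop where
  wide : ∀ i, P (b i).level → bw (b i).level < 2 * w i
  le : ∀ i, P (b i).level → w i ≤ bw (b i).level
  xpos : ∀ i, P (b i).level → x i = cx (b i)
  ylow : ∀ i, P (b i).level → cy (b i) ≤ y i
  yhigh : ∀ i, P (b i).level → y i + h i ≤ cy (b i) + total b h (b i)
  fits : ∀ i, P (b i).level → total b h (b i) ≤ bh (b i).level
  full : ∀ i j, P (b i).level → b i ≠ b j → (b i).level = (b j).level →
    bh (b i).level < total b h (b i) + total b h (b j)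

/-- A finite family of pieces that lies in the bricks as after a run of BrickTranslation, together
with the width `W` and the height `H` of a box that is at least as wide and as high as every piece
and whose area is at least the total area of the pieces. -/
structure Layout {ι : Type*} [Fintype ι] (b : ι → DerivedBrick) (w h x y : ι → ℝ) (W H : ℝ) :
    Prop where
  w_pos : ∀ i, 0 < w i
  h_pos : ∀ i, 0 < h i
  even : Stacked Even brickWidth brickHeight (fun D => D.toBrick.corner.1)
    (fun D => D.toBrick.corner.2) b w h x y
  odd : Stacked (fun k => ¬ Even k) brickHeight brickWidth (fun D => D.toBrick.corner.2)
    (fun D => D.toBrick.corner.1) b h w y x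
  eq_of_comparable : ∀ i j, (b i).Comparable (b j) → b i = b j
  exists_comparable : ∀ i, ∀ E : DerivedBrick, E.level = (b i).level → E.code < (b i).code →
    ∃ j, E.Comparable (b j)
  w_le : ∀ i, w i ≤ W
  h_le : ∀ i, h i ≤ H
  area_le : ∑ i, w i * h i ≤ W * H

namespace DerivedBrick

/-- The derived brick with the same splits whose root has an index smaller by `n`. -/
def shift (n : ℤ) (D : DerivedBrick) : DerivedBrick := ⟨D.root - n, D.path⟩

theorem shift_level (n : ℤ) (D : DerivedBrick) : (D.shift n).level = D.level - n := by
  simp only [shift, level]; ring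

theorem shift_injective (n : ℤ) : Function.Injective (shift n) := by
  intro D E h
  simp only [shift, DerivedBrick.mk.injEq, sub_left_inj] at h
  exact DerivedBrick.ext h.1 h.2

theorem shift_comparable {n : ℤ} {D E : DerivedBrick} :
    (D.shift n).Comparable (E.shift n) ↔ D.Comparable E := by
  simp [Comparable, Refines, shift]

end DerivedBrick

theorem even_sub_iff_of_odd {n : ℤ} (hn : Odd n) (k : ℤ) : Even (k - n) ↔ ¬ Even k := by
  rw [Int.even_sub]
  have : ¬ Even n := Int.not_even_iff_odd.2 hn
  tauto

theorem brickWidth_sub {n : ℤ} (hn : Odd n) (k : ℤ) :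
    brickWidth (k - n) = √2 ^ n * brickHeight k := by
  have h0 : √2 ≠ 0 := by positivity
  unfold brickWidth brickHeight
  by_cases h : Even k
  · rw [if_neg (by rw [even_sub_iff_of_odd hn]; exact not_not.2 h), if_pos h, ← zpow_add₀ h0]
    congr 1; ring
  · rw [if_pos ((even_sub_iff_of_odd hn k).2 h), if_neg h, ← zpow_add₀ h0]
    congr 1; ring

theorem brickHeight_sub {n : ℤ} (hn : Odd n) (k : ℤ) :
    brickHeight (k - n) = √2 ^ n * brickWidth k := by
  have h0 : √2 ≠ 0 := by positivity
  unfold brickWidth brickHeight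
  by_cases h : Even k
  · rw [if_neg (by rw [even_sub_iff_of_odd hn]; exact not_not.2 h), if_pos h, ← zpow_add₀ h0]
    congr 1; ring
  · rw [if_pos ((even_sub_iff_of_odd hn k).2 h), if_neg h, ← zpow_add₀ h0]
    congr 1; ring

/-- An odd shift of the levels reflects the bricks in the diagonal and scales them. -/
theorem shift_corner {n : ℤ} (hn : Odd n) (D : DerivedBrick) :
    (D.shift n).toBrick.corner.1 = √2 ^ n * D.toBrick.corner.2 ∧
      (D.shift n).toBrick.corner.2 = √2 ^ n * D.toBrick.corner.1 := by
  have h0 : √2 ≠ 0 := by positivity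
  have key : ∀ (l : List Bool) (B B' : Brick), B'.level = B.level - n →
      B'.corner.1 = √2 ^ n * B.corner.2 → B'.corner.2 = √2 ^ n * B.corner.1 →
      (l.foldl Brick.split B').corner.1 = √2 ^ n * (l.foldl Brick.split B).corner.2 ∧
      (l.foldl Brick.split B').corner.2 = √2 ^ n * (l.foldl Brick.split B).corner.1 := by
    intro l
    induction l with
    | nil => intro B B' _ h1 h2; exact ⟨h1, h2⟩
    | cons c l ih =>
      intro B B' hl h1 h2
      have hw := brickWidth_sub hn (B.level + 1)
      have hh := brickHeight_sub hn (B.level + 1)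
      rw [show B.level + 1 - n = B.level - n + 1 by ring] at hw hh
      apply ih
      · simp only [Brick.split, hl]; ring
      · cases c
        · simpa [Brick.split] using h1
        · by_cases h : Even B.level
          · have h' : ¬ Even (B.level - n) := by rw [even_sub_iff_of_odd hn]; exact not_not.2 h
            simp [Brick.split, hl, h, h', h1]
          · have h' : Even (B.level - n) := (even_sub_iff_of_odd hn _).2 h
            simp [Brick.split, hl, h, h', h1, hw]; ring
      · cases c
        · simpa [Brick.split] using h2
        · by_cases h : Even B.level
          · have h' : ¬ Even (B.level - n) := by rw [even_sub_iff_of_odd hn]; exact not_not.2 h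
            simp [Brick.split, hl, h, h', h2, hh]; ring
          · have h' : Even (B.level - n) := (even_sub_iff_of_odd hn _).2 h
            simp [Brick.split, hl, h, h', h2]
  apply key
  · rfl
  · by_cases h : Even D.root
    · have h' : ¬ Even (D.root - n) := by rw [even_sub_iff_of_odd hn]; exact not_not.2 h
      simp only [fundamentalBrick, DerivedBrick.shift, h, h', if_true, if_false]
      rw [← zpow_add₀ h0]; congr 1; ring
    · have h' : Even (D.root - n) := (even_sub_iff_of_odd hn _).2 h
      simp [fundamentalBrick, DerivedBrick.shift, h, h']
  · by_cases h : Even D.root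
    · have h' : ¬ Even (D.root - n) := by rw [even_sub_iff_of_odd hn]; exact not_not.2 h
      simp [fundamentalBrick, DerivedBrick.shift, h, h']
    · have h' : Even (D.root - n) := (even_sub_iff_of_odd hn _).2 h
      simp only [fundamentalBrick, DerivedBrick.shift, h, h', if_true, if_false]
      rw [← zpow_add₀ h0]; congr 1; ring

section

variable {ι : Type*} [Fintype ι] {b : ι → DerivedBrick} {w h x y : ι → ℝ} {W H : ℝ}

theorem total_shift (n : ℤ) (s : ℝ) (f : ι → ℝ) (D : DerivedBrick) :
    total (fun i => (b i).shift n) (fun i => s * f i) (D.shift n) = s * total b f D := by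
  classical
  simp only [total, (DerivedBrick.shift_injective n).eq_iff, Finset.mul_sum]

theorem Stacked.shift {P P' : ℤ → Prop} {bw bh bw' bh' : ℤ → ℝ} {cx cy cx' cy' : DerivedBrick → ℝ}
    (hS : Stacked P bw bh cx cy b w h x y) (n : ℤ) {s : ℝ} (hs : 0 < s)
    (hP : ∀ k, P' (k - n) → P k) (hbw : ∀ k, bw' (k - n) = s * bw k)
    (hbh : ∀ k, bh' (k - n) = s * bh k) (hcx : ∀ D, cx' (D.shift n) = s * cx D)
    (hcy : ∀ D, cy' (D.shift n) = s * cy D) :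
    Stacked P' bw' bh' cx' cy' (fun i => (b i).shift n) (fun i => s * w i) (fun i => s * h i)
      (fun i => s * x i) (fun i => s * y i) := by
  constructor
  · intro i hi
    rw [DerivedBrick.shift_level] at hi ⊢
    rw [hbw]
    have := mul_lt_mul_of_pos_left (hS.wide i (hP _ hi)) hs
    linarith
  · intro i hi
    rw [DerivedBrick.shift_level] at hi ⊢
    rw [hbw]
    exact mul_le_mul_of_nonneg_left (hS.le i (hP _ hi)) hs.le
  · intro i hi
    rw [DerivedBrick.shift_level] at hi
    rw [hcx, hS.xpos i (hP _ hi)]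
  · intro i hi
    rw [DerivedBrick.shift_level] at hi
    rw [hcy]
    exact mul_le_mul_of_nonneg_left (hS.ylow i (hP _ hi)) hs.le
  · intro i hi
    rw [DerivedBrick.shift_level] at hi
    rw [hcy, total_shift, ← mul_add, ← mul_add]
    exact mul_le_mul_of_nonneg_left (hS.yhigh i (hP _ hi)) hs.le
  · intro i hi
    rw [DerivedBrick.shift_level] at hi ⊢
    rw [hbh, total_shift]
    exact mul_le_mul_of_nonneg_left (hS.fits i (hP _ hi)) hs.le
  · intro i j hi hne hl
    rw [DerivedBrick.shift_level] at hi
    simp only [DerivedBrick.shift_level, sub_left_inj] at hl ⊢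
    rw [hbh, total_shift, total_shift, ← mul_add]
    exact mul_lt_mul_of_pos_left
      (hS.full i j (hP _ hi) (fun h => hne (congrArg _ h)) hl) hs

/-- Layouts are preserved by a reflection in the diagonal with a scaling by an odd power of `√2`. -/
theorem Layout.shift (L : Layout b w h x y W H) {n : ℤ} (hn : Odd n) :
    Layout (fun i => (b i).shift n) (fun i => √2 ^ n * h i) (fun i => √2 ^ n * w i)
      (fun i => √2 ^ n * y i) (fun i => √2 ^ n * x i) (√2 ^ n * H) (√2 ^ n * W) := by
  have hs : 0 < √2 ^ n := by positivity
  refine ⟨fun i => mul_pos hs (L.h_pos i), fun i => mul_pos hs (L.w_pos i), ?_, ?_, ?_, ?_,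
    fun i => mul_le_mul_of_nonneg_left (L.h_le i) hs.le,
    fun i => mul_le_mul_of_nonneg_left (L.w_le i) hs.le, ?_⟩
  · exact L.odd.shift n hs (fun k => (even_sub_iff_of_odd hn k).1) (brickWidth_sub hn)
      (brickHeight_sub hn) (fun D => (shift_corner hn D).1) (fun D => (shift_corner hn D).2)
  · refine L.even.shift n hs (fun k hk => ?_) (brickHeight_sub hn) (brickWidth_sub hn)
      (fun D => (shift_corner hn D).2) (fun D => (shift_corner hn D).1)
    rwa [even_sub_iff_of_odd hn, not_not] at hk
  · intro i j hc
    rw [L.eq_of_comparable i j (DerivedBrick.shift_comparable.1 hc)]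
  · intro i E hl hc
    have hE : E = (E.shift (-n)).shift n := by simp [DerivedBrick.shift]
    obtain ⟨j, hj⟩ := L.exists_comparable i (E.shift (-n))
      (by rw [DerivedBrick.shift_level] at hl ⊢; omega) hc
    exact ⟨j, by rw [hE, DerivedBrick.shift_comparable]; exact hj⟩
  · have h1 : ∑ i, √2 ^ n * h i * (√2 ^ n * w i) = √2 ^ n * √2 ^ n * ∑ i, w i * h i := by
      rw [Finset.mul_sum]
      exact Finset.sum_congr rfl fun i _ => by ring
    rw [h1, show √2 ^ n * H * (√2 ^ n * W) = √2 ^ n * √2 ^ n * (W * H) by ring]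
    exact mul_le_mul_of_nonneg_left L.area_le (by positivity)

/-- It suffices to bound the extent of the layout up to two pieces when the larger of the
fundamental bricks around them is `B₀`. -/
theorem Layout.bound_of_normalized {c : ℝ}
    (hbase : ∀ (b : ι → DerivedBrick) (w h x y : ι → ℝ) (W H : ℝ), Layout b w h x y W H →
      ∀ i j, 0 ≤ (b i).root → 0 ≤ (b j).root → (b i).root = 0 ∨ (b j).root = 0 →
        x i + w i + (y j + h j) ≤ c * (W + H))
    (L : Layout b w h x y W H) (i j : ι) : x i + w i + (y j + h j) ≤ c * (W + H) := by
  have hodd : ∀ (b : ι → DerivedBrick) (w h x y : ι → ℝ) (W H : ℝ), Layout b w h x y W H →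
      ∀ i j, Odd (min (b i).root (b j).root) → x i + w i + (y j + h j) ≤ c * (W + H) := by
    intro b w h x y W H L i j hn
    have hs : 0 < √2 ^ (min (b i).root (b j).root) := by positivity
    have := hbase _ _ _ _ _ _ _ (L.shift hn) j i (by simp [DerivedBrick.shift])
      (by simp [DerivedBrick.shift]) (by simp only [DerivedBrick.shift]; omega)
    refine le_of_mul_le_mul_left ?_ hs
    linarith
  rcases Int.even_or_odd (min (b i).root (b j).root) with hn | hn
  · have hone : Odd (1 : ℤ) := odd_one
    have hs : (0 : ℝ) < √2 ^ (1 : ℤ) := by positivity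
    have := hodd _ _ _ _ _ _ _ (L.shift hone) j i (by
      have : min ((b j).root - 1) ((b i).root - 1) = min (b i).root (b j).root - 1 := by omega
      simp only [DerivedBrick.shift, this]
      exact hn.sub_odd hone)
    refine le_of_mul_le_mul_left ?_ hs
    linarith
  · exact hodd _ _ _ _ _ _ _ L i j hn

end

/-! ### Areas of the levels -/

section

variable {ι : Type*} [Fintype ι] {b : ι → DerivedBrick} {w h x y : ι → ℝ} {W H : ℝ}

/-- Two bricks of a level are together filled more than once, so two or more bricks of
a level are half filled on average. -/
theorem Stacked.card_mul_le_sum_total {P : ℤ → Prop} {bw bh : ℤ → ℝ} {cx cy : DerivedBrick → ℝ}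
    (hS : Stacked P bw bh cx cy b w h x y) {k : ℤ} (hk : P k) {B : Finset DerivedBrick}
    (hB : ∀ D ∈ B, D.level = k ∧ ∃ i, b i = D) (hcard : 2 ≤ B.card) :
    B.card * bh k ≤ 2 * ∑ D ∈ B, total b h D := by
  classical
  set T := ∑ D ∈ B, total b h D with hT
  have hpair : ∀ D ∈ B, ∀ E ∈ B.erase D, bh k ≤ total b h D + total b h E := by
    intro D hD E hE
    obtain ⟨hne, hE'⟩ := Finset.mem_erase.1 hE
    obtain ⟨hDk, i, rfl⟩ := hB D hD
    obtain ⟨hEk, j, rfl⟩ := hB E hE'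
    have := hS.full i j (by rwa [hDk]) hne.symm (hDk.trans hEk.symm)
    rw [hDk] at this
    exact this.le
  have hrow : ∀ D ∈ B, ((B.card : ℝ) - 1) * bh k ≤
      ((B.card : ℝ) - 1) * total b h D + (T - total b h D) := by
    intro D hD
    have h1 := Finset.sum_le_sum (hpair D hD)
    have hc : ((B.erase D).card : ℝ) = B.card - 1 := by
      rw [Finset.card_erase_of_mem hD, Nat.cast_sub (by omega), Nat.cast_one]
    rw [Finset.sum_const, nsmul_eq_mul, Finset.sum_add_distrib, Finset.sum_const, nsmul_eq_mul, hc,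
      Finset.sum_erase_eq_sub hD] at h1
    exact h1
  have h2 := Finset.sum_le_sum hrow
  rw [Finset.sum_const, nsmul_eq_mul, Finset.sum_add_distrib, ← Finset.mul_sum,
    Finset.sum_sub_distrib, Finset.sum_const, nsmul_eq_mul, ← hT] at h2
  have hc : (2 : ℝ) ≤ B.card := by exact_mod_cast hcard
  have h3 : ((B.card : ℝ) - 1) * (B.card * bh k) ≤ ((B.card : ℝ) - 1) * (2 * T) := by linarith
  exact le_of_mul_le_mul_left h3 (by linarith)

open Classical in
theorem Stacked.card_mul_le_sum_area {P : ℤ → Prop} {bw bh : ℤ → ℝ} {cx cy : DerivedBrick → ℝ}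
    (hS : Stacked P bw bh cx cy b w h x y) (hh : ∀ i, 0 < h i) {k : ℤ} (hk : P k) (hbw : 0 < bw k)
    {B : Finset DerivedBrick} (hB : ∀ D ∈ B, D.level = k ∧ ∃ i, b i = D) (hcard : 2 ≤ B.card) :
    B.card * (bw k * bh k / 4) ≤ ∑ i with b i ∈ B, w i * h i := by
  have h1 := hS.card_mul_le_sum_total hk hB hcard
  have h2 : ∑ i with b i ∈ B, w i * h i = ∑ D ∈ B, ∑ i with b i = D, w i * h i := by
    rw [← Finset.sum_fiberwise_of_maps_to (s := Finset.univ.filter fun i => b i ∈ B) (t := B)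
      (g := b) (fun i hi => (Finset.mem_filter.1 hi).2)]
    refine Finset.sum_congr rfl fun D hD => Finset.sum_congr ?_ fun _ _ => rfl
    ext i
    simp only [Finset.mem_filter, Finset.mem_univ, true_and]
    exact ⟨fun h => h.2, fun h => ⟨h ▸ hD, h⟩⟩
  have h3 : ∀ D ∈ B, bw k / 2 * total b h D ≤ ∑ i with b i = D, w i * h i := by
    intro D hD
    rw [total, Finset.mul_sum]
    refine Finset.sum_le_sum fun i hi => ?_
    have hi' : b i = D := (Finset.mem_filter.1 hi).2
    have hl : (b i).level = k := by rw [hi']; exact (hB D hD).1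
    have := hS.wide i (by rwa [hl])
    rw [hl] at this
    exact mul_le_mul_of_nonneg_right (by linarith) (hh i).le
  have h4 := Finset.sum_le_sum h3
  rw [← Finset.mul_sum] at h4
  rw [h2]
  refine le_trans ?_ h4
  nlinarith

theorem brickWidth_mul_brickHeight (j : ℕ) :
    brickWidth j * brickHeight j = √2 / 2 * (1 / 2) ^ j := by
  have h0 : √2 ≠ 0 := by positivity
  have h1 : brickWidth j * brickHeight j = √2 ^ (-(j : ℤ)) * √2 ^ (-(j : ℤ) - 1) := by
    unfold brickWidth brickHeight
    split_ifs
    · rfl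
    · ring
  have h2 : √2 ^ (-(j : ℤ)) * √2 ^ (-(j : ℤ)) = (1 / 2) ^ j := by
    rw [zpow_neg, zpow_natCast, ← mul_inv, ← mul_pow, Real.mul_self_sqrt (by norm_num), one_div,
      inv_pow]
  rw [h1, zpow_sub_one₀ h0, ← mul_assoc, h2]
  have h3 : (√2)⁻¹ = √2 / 2 := by
    rw [inv_eq_one_div, div_eq_div_iff h0 two_ne_zero, Real.mul_self_sqrt (by norm_num)]
    norm_num
  rw [h3, mul_comm]

open Classical in
/-- The bricks in use that lie in the union of the fundamental bricks of nonnegative index. -/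
noncomputable def usedBricks (b : ι → DerivedBrick) : Finset DerivedBrick :=
  {D ∈ Finset.univ.image b | 0 ≤ D.root}

theorem mem_usedBricks {D : DerivedBrick} :
    D ∈ usedBricks b ↔ (∃ i, b i = D) ∧ 0 ≤ D.root := by
  simp [usedBricks]

theorem level_nonneg_of_mem {D : DerivedBrick} (hD : D ∈ usedBricks b) : 0 ≤ D.level :=
  add_nonneg (mem_usedBricks.1 hD).2 (by positivity)

/-- The bricks in use of level `j`. -/
noncomputable def usedAt (b : ι → DerivedBrick) (j : ℕ) : Finset DerivedBrick :=
  {D ∈ usedBricks b | D.level = j}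

theorem mem_usedAt {D : DerivedBrick} {j : ℕ} :
    D ∈ usedAt b j ↔ D ∈ usedBricks b ∧ D.level = j := Finset.mem_filter

/-- The total area of the pieces packed in bricks of level `j`. -/
noncomputable def levelArea (b : ι → DerivedBrick) (w h : ι → ℝ) (j : ℕ) : ℝ :=
  ∑ i with 0 ≤ (b i).root ∧ (b i).level = j, w i * h i

theorem Layout.levelArea_nonneg (L : Layout b w h x y W H) (j : ℕ) : 0 ≤ levelArea b w h j :=
  Finset.sum_nonneg fun i _ => (mul_pos (L.w_pos i) (L.h_pos i)).le

theorem Layout.card_mul_le_levelArea (L : Layout b w h x y W H) {j : ℕ}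
    (hj : 2 ≤ (usedAt b j).card) :
    √2 / 8 * ((usedAt b j).card * (1 / 2) ^ j) ≤ levelArea b w h j := by
  classical
  have hB : ∀ D ∈ usedAt b j, D.level = j ∧ ∃ i, b i = D := fun D hD =>
    ⟨(mem_usedAt.1 hD).2, (mem_usedBricks.1 (mem_usedAt.1 hD).1).1⟩
  have hsum : ∑ i with b i ∈ usedAt b j, w i * h i = levelArea b w h j := by
    refine Finset.sum_congr ?_ fun _ _ => rfl
    ext i
    simp [mem_usedAt, mem_usedBricks]
  have harea := brickWidth_mul_brickHeight j
  rw [← hsum]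
  by_cases hP : Even (j : ℤ)
  · have := L.even.card_mul_le_sum_area L.h_pos hP (brickWidth_pos _) hB hj
    rw [harea] at this
    linarith
  · have := L.odd.card_mul_le_sum_area L.w_pos hP (brickHeight_pos _) hB hj
    rw [mul_comm (brickHeight _), harea] at this
    simp only [mul_comm (h _)] at this
    linarith

theorem sum_half_pow_le {J : Finset ℕ} {j₀ : ℕ} (hJ : ∀ j ∈ J, j₀ ≤ j) :
    ∑ j ∈ J, (1 / 2 : ℝ) ^ j ≤ 2 * (1 / 2) ^ j₀ := by
  have hIco : ∀ n, ∑ j ∈ Finset.Ico j₀ (j₀ + n), (1 / 2 : ℝ) ^ j =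
      2 * (1 / 2) ^ j₀ - 2 * (1 / 2) ^ (j₀ + n) := by
    intro n
    induction n with
    | zero => simp
    | succ n ih =>
      rw [← add_assoc, Finset.sum_Ico_succ_top (by omega), ih, pow_succ]
      ring
  have hsub : J ⊆ Finset.Ico j₀ (j₀ + (J.sup id + 1)) := fun j hj => by
    have h1 := hJ j hj
    have h2 : j ≤ J.sup id := Finset.le_sup (f := id) hj
    exact Finset.mem_Ico.2 ⟨h1, by omega⟩
  refine (Finset.sum_le_sum_of_subset_of_nonneg hsub fun _ _ _ => by positivity).trans ?_
  rw [hIco]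
  have : (0 : ℝ) < (1 / 2) ^ (j₀ + (J.sup id + 1)) := by positivity
  linarith

/-- The total measure, in units of a brick of level `0`, of the bricks in use of level at least
`2`. -/
noncomputable def deepMeasure (b : ι → DerivedBrick) : ℝ :=
  ∑ D ∈ usedBricks b with 2 ≤ D.level, (1 / 2 : ℝ) ^ D.level.toNat

/-- The bricks of a level are dense unless there is just one of them, so all but a set of
measure `∑_{j ≥ j₀} 1 / 2 ^ j` of the bricks in use is dense if no level below `j₀` has exactly
one brick. -/
theorem Layout.levelArea_add_le_area (L : Layout b w h x y W H) {j₀ : ℕ}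
    (hj₀ : ∀ j, 2 ≤ j → j < j₀ → (usedAt b j).card ≠ 1) :
    levelArea b w h 1 + √2 / 8 * (deepMeasure b - 2 * (1 / 2) ^ j₀) ≤ W * H := by
  classical
  set B := (usedBricks b).filter fun D => 2 ≤ D.level with hB
  set J := B.image fun D => D.level.toNat with hJ
  have hJ2 : ∀ j ∈ J, 2 ≤ j := by
    intro j hj
    obtain ⟨D, hD, rfl⟩ := Finset.mem_image.1 hj
    have := (Finset.mem_filter.1 hD).2
    omega
  have hdeep : deepMeasure b = ∑ j ∈ J, (usedAt b j).card * (1 / 2 : ℝ) ^ j := by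
    rw [deepMeasure, ← Finset.sum_fiberwise_of_maps_to (s := B) (t := J)
      (g := fun D => D.level.toNat) (fun D hD => Finset.mem_image_of_mem _ hD)]
    refine Finset.sum_congr rfl fun j hj => ?_
    have hset : (B.filter fun D => D.level.toNat = j) = usedAt b j := by
      ext D
      simp only [hB, Finset.mem_filter, mem_usedAt, and_assoc]
      have := hJ2 j hj
      constructor
      · rintro ⟨h1, h2, h3⟩; exact ⟨h1, by omega⟩
      · rintro ⟨h1, h2⟩; exact ⟨h1, by omega, by omega⟩
    rw [hset, ← nsmul_eq_mul, ← Finset.sum_const]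
    refine Finset.sum_congr rfl fun D hD => ?_
    rw [(mem_usedAt.1 hD).2, Int.toNat_natCast]
  have hlevel : ∀ j ∈ J, √2 / 8 * ((usedAt b j).card * (1 / 2) ^ j -
      if j₀ ≤ j then (1 / 2) ^ j else 0) ≤ levelArea b w h j := by
    intro j hj
    have hp : (0 : ℝ) < (1 / 2) ^ j := by positivity
    have hs : 0 < √2 / 8 := by positivity
    have h0 := L.levelArea_nonneg j
    by_cases hc : 2 ≤ (usedAt b j).card
    · refine le_trans (mul_le_mul_of_nonneg_left ?_ hs.le) (L.card_mul_le_levelArea hc)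
      split_ifs <;> linarith
    · have hc1 : ((usedAt b j).card : ℝ) ≤ 1 := by exact_mod_cast Nat.lt_succ_iff.1 (not_le.1 hc)
      split_ifs with hjj
      · have : ((usedAt b j).card : ℝ) * (1 / 2) ^ j - (1 / 2) ^ j ≤ 0 := by nlinarith
        nlinarith
      · have h1 := hj₀ j (hJ2 j hj) (by omega)
        have : (usedAt b j).card = 0 := by omega
        rw [this]
        simpa using h0
  have htotal : ∑ j ∈ insert 1 J, levelArea b w h j ≤ ∑ i, w i * h i := by
    have h1 : ∀ j ∈ insert 1 J, levelArea b w h j =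
        ∑ i ∈ Finset.univ.filter fun i => 0 ≤ (b i).root ∧ 0 ≤ (b i).level ∧
          (b i).level.toNat ∈ insert 1 J with (b i).level.toNat = j, w i * h i := by
      intro j hj
      refine Finset.sum_congr ?_ fun _ _ => rfl
      ext i
      simp only [Finset.mem_filter, Finset.mem_univ, true_and]
      constructor
      · rintro ⟨h1, h2⟩
        exact ⟨⟨h1, by omega, by rwa [h2, Int.toNat_natCast]⟩, by omega⟩
      · rintro ⟨⟨h1, h2, _⟩, h3⟩
        exact ⟨h1, by omega⟩
    rw [Finset.sum_congr rfl h1, Finset.sum_fiberwise_of_maps_to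
      (fun i hi => (Finset.mem_filter.1 hi).2.2.2)]
    exact Finset.sum_le_sum_of_subset_of_nonneg (Finset.filter_subset _ _)
      fun i _ _ => (mul_pos (L.w_pos i) (L.h_pos i)).le
  have h1J : 1 ∉ J := fun h => by have := hJ2 1 h; omega
  rw [Finset.sum_insert h1J] at htotal
  have h2 := Finset.sum_le_sum hlevel
  rw [← Finset.mul_sum, Finset.sum_sub_distrib, ← hdeep, ← Finset.sum_filter] at h2
  have h3 := sum_half_pow_le (J := J.filter fun j => j₀ ≤ j) fun j hj => (Finset.mem_filter.1 hj).2
  have h4 : √2 / 8 * (deepMeasure b - 2 * (1 / 2) ^ j₀) ≤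
      √2 / 8 * (deepMeasure b - ∑ j ∈ J with j₀ ≤ j, (1 / 2 : ℝ) ^ j) :=
    mul_le_mul_of_nonneg_left (by linarith) (by positivity)
  linarith [L.area_le]

/-! ### The part of the bricks in use -/

/-- The invariant that no brick preceding a brick in use of the same level is free, in terms of
dyadic intervals. -/
theorem Layout.firstFit (L : Layout b w h x y W H) :
    Dyadic.FirstFit ((usedBricks b).image fun D => (D.level.toNat, D.code)) := by
  classical
  intro p hp n hn hlt
  obtain ⟨D, hD, rfl⟩ := Finset.mem_image.1 hp
  have hD0 := level_nonneg_of_mem hD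
  obtain ⟨⟨i, rfl⟩, hr⟩ := mem_usedBricks.1 hD
  obtain ⟨E, hE, rfl⟩ := DerivedBrick.exists_code_eq (b i).level hn
  obtain ⟨j, hj⟩ := L.exists_comparable i E hE hlt
  have hEr : 0 ≤ E.root := hr.trans (DerivedBrick.root_le_of_code_lt hE hlt)
  have hjr : 0 ≤ (b j).root := hj.root_eq ▸ hEr
  have hj0 : b j ∈ usedBricks b := mem_usedBricks.2 ⟨⟨j, rfl⟩, hjr⟩
  have hjl := level_nonneg_of_mem hj0
  refine ⟨_, Finset.mem_image_of_mem _ hj0, ?_⟩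
  rcases hj with hj | hj
  · obtain ⟨m, hm, hc⟩ := hj.code_div
    refine Or.inr ⟨by simp only; omega, ?_⟩
    simp only
    rw [show (b i).level.toNat - (b j).level.toNat = m by omega, hc]
  · obtain ⟨m, hm, hc⟩ := hj.code_div
    refine Or.inl ⟨by simp only; omega, ?_⟩
    simp only
    rw [show (b j).level.toNat - (b i).level.toNat = m by omega, hc]

/-- If a piece lies in the brick `⟨r, p⟩`, then the bricks in use up to that brick have measure at
least `code / 2 ^ level`. -/
theorem Layout.le_sum_of_refines (L : Layout b w h x y W H) {i : ι} {r : ℕ} {p : List Bool}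
    (hi : (b i).Refines ⟨r, p⟩) :
    (appendBits 1 p : ℝ) / 2 ^ (r + p.length) ≤
      ∑ D ∈ usedBricks b with
        D.code * 2 ^ (r + p.length) < (appendBits 1 p + 1) * 2 ^ D.level.toNat,
        (1 / 2 : ℝ) ^ D.level.toNat := by
  classical
  have hmem : b i ∈ usedBricks b := mem_usedBricks.2 ⟨⟨i, rfl⟩, by rw [hi.1]; positivity⟩
  obtain ⟨m, hm, hc⟩ := hi.code_div
  simp only [DerivedBrick.level] at hm
  have hm' : (b i).level.toNat = r + p.length + m := by
    simp only [DerivedBrick.level]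
    omega
  have h1 := L.firstFit.le_sum (Finset.mem_image_of_mem _ hmem) (m₀ := r + p.length)
    (n₀ := appendBits 1 p) (by simp only [hm']; omega)
    (by simp only [hm', Nat.add_sub_cancel_left]; exact hc)
  rw [Finset.filter_image, Finset.sum_image] at h1
  · exact h1
  · intro D hD E hE h
    have hD0 := level_nonneg_of_mem (Finset.mem_filter.1 hD).1
    have hE0 := level_nonneg_of_mem (Finset.mem_filter.1 hE).1
    simp only [Prod.mk.injEq] at h
    exact DerivedBrick.eq_of_code_eq (by omega) h.2

/-- The bricks of level `1` do not enter the bound if they all come after `⟨r, p⟩`. -/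
theorem Layout.le_deepMeasure (L : Layout b w h x y W H) {i : ι} {r : ℕ} {p : List Bool}
    (h0 : ∀ D ∈ usedBricks b, D.level ≠ 0)
    (hi : (b i).Refines ⟨r, p⟩)
    (hD : ∀ D ∈ usedAt b 1, (appendBits 1 p + 1) * 2 ≤ D.code * 2 ^ (r + p.length)) :
    (appendBits 1 p : ℝ) / 2 ^ (r + p.length) ≤ deepMeasure b := by
  refine (L.le_sum_of_refines hi).trans ?_
  refine Finset.sum_le_sum_of_subset_of_nonneg ?_ fun _ _ _ => by positivity
  intro D hD'
  obtain ⟨hDu, hlt⟩ := Finset.mem_filter.1 hD'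
  refine Finset.mem_filter.2 ⟨hDu, ?_⟩
  by_contra hlt2
  have h1 := level_nonneg_of_mem hDu
  have h2 := h0 D hDu
  have hl : D.level = 1 := by omega
  have h3 := hD D (mem_usedAt.2 ⟨hDu, by exact_mod_cast hl⟩)
  rw [hl] at hlt
  simp only [Int.toNat_one, pow_one] at hlt
  omega

/-- A single brick of level `1` contributes at most its measure `1 / 2`. -/
theorem Layout.le_deepMeasure_add_half (L : Layout b w h x y W H) {i : ι} {r : ℕ} {p : List Bool}
    (h0 : ∀ D ∈ usedBricks b, D.level ≠ 0) (h1 : (usedAt b 1).card ≤ 1)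
    (hi : (b i).Refines ⟨r, p⟩) :
    (appendBits 1 p : ℝ) / 2 ^ (r + p.length) ≤ deepMeasure b + 1 / 2 := by
  classical
  refine (L.le_sum_of_refines hi).trans ?_
  have hsub : (usedBricks b).filter (fun D =>
      D.code * 2 ^ (r + p.length) < (appendBits 1 p + 1) * 2 ^ D.level.toNat) ⊆
      (usedBricks b).filter (fun D => 2 ≤ D.level) ∪ usedAt b 1 := by
    intro D hD
    have hDu := (Finset.mem_filter.1 hD).1
    have h1 := level_nonneg_of_mem hDu
    have h2 := h0 D hDu
    by_cases hl : 2 ≤ D.level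
    · exact Finset.mem_union_left _ (Finset.mem_filter.2 ⟨hDu, hl⟩)
    · exact Finset.mem_union_right _ (mem_usedAt.2 ⟨hDu, by push_cast; omega⟩)
  refine (Finset.sum_le_sum_of_subset_of_nonneg hsub fun _ _ _ => by positivity).trans ?_
  have hdisj : Disjoint ((usedBricks b).filter fun D => 2 ≤ D.level) (usedAt b 1) := by
    rw [Finset.disjoint_left]
    intro D hD hD'
    have e1 := (Finset.mem_filter.1 hD).2
    have e2 := (mem_usedAt.1 hD').2
    push_cast at e2
    omega
  rw [Finset.sum_union hdisj]
  refine add_le_add le_rfl ?_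
  have : ∑ D ∈ usedAt b 1, (1 / 2 : ℝ) ^ D.level.toNat = (usedAt b 1).card * (1 / 2) := by
    rw [← nsmul_eq_mul, ← Finset.sum_const]
    refine Finset.sum_congr rfl fun D hD => ?_
    rw [(mem_usedAt.1 hD).2]; simp
  rw [this]
  have hc : ((usedAt b 1).card : ℝ) ≤ 1 := by exact_mod_cast h1
  linarith

end

/-! ### Positions in the largest bricks -/

theorem sqrt_two_bounds : 1.41421 < √2 ∧ √2 < 1.41422 := by
  constructor
  · rw [Real.lt_sqrt] <;> norm_num
  · rw [Real.sqrt_lt'] <;> norm_num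

theorem sqrt_two_sq : √2 * √2 = 2 := Real.mul_self_sqrt (by norm_num)

theorem sqrt_two_inv : √2 ^ (-1 : ℤ) = √2 / 2 := by
  rw [zpow_neg_one, inv_eq_one_div, div_eq_div_iff (by positivity) two_ne_zero, sqrt_two_sq]
  norm_num

theorem brickWidth_zero : brickWidth 0 = 1 := by simp [brickWidth]

theorem brickHeight_zero : brickHeight 0 = √2 / 2 := by
  simp only [brickHeight, Even.zero, if_true]
  rw [← sqrt_two_inv]; congr 1

theorem brickWidth_one : brickWidth 1 = 1 / 2 := by
  have := brickWidth_succ_of_even (k := 0) (by decide)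
  rw [brickWidth_zero, zero_add] at this
  linarith

theorem brickHeight_one : brickHeight 1 = √2 / 2 := by
  have := brickHeight_succ_of_even (k := 0) (by decide)
  rwa [brickHeight_zero, zero_add] at this

theorem brickWidth_two : brickWidth 2 = 1 / 2 := by
  have := brickWidth_succ_of_not_even (k := 1) (by decide)
  rwa [brickWidth_one] at this

theorem brickHeight_two : brickHeight 2 = √2 / 4 := by
  have := brickHeight_succ_of_not_even (k := 1) (by decide)
  rw [brickHeight_one] at this
  norm_num at this
  linarith

theorem brickWidth_three : brickWidth 3 = 1 / 4 := by
  have := brickWidth_succ_of_even (k := 2) (by decide)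
  rw [brickWidth_two] at this
  norm_num at this
  linarith

theorem fundamentalBrick_zero_corner : (fundamentalBrick 0).corner = (0, √2 / 2) := by
  rw [← sqrt_two_inv]; simp [fundamentalBrick]

theorem fundamentalBrick_one_corner : (fundamentalBrick 1).corner = (1 / 2, 0) := by
  have h : ¬ Even (1 : ℤ) := by decide
  have : √2 ^ (-1 - 1 : ℤ) = 1 / 2 := by
    rw [zpow_sub_one₀ (by positivity), ← zpow_neg_one, sqrt_two_inv]
    linarith [sqrt_two_sq]
  simp only [fundamentalBrick, h, if_false, this]

theorem fundamentalBrick_extent {k : ℤ} (hk : 2 ≤ k) :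
    (fundamentalBrick k).corner.1 + brickWidth k ≤ 1 / 2 ∧
      (fundamentalBrick k).corner.2 + brickHeight k ≤ √2 / 2 := by
  have hmono : ∀ {a b : ℤ}, a ≤ b → √2 ^ a ≤ √2 ^ b := fun h =>
    zpow_le_zpow_right₀ (by rw [Real.one_le_sqrt]; norm_num) h
  have h1 := sqrt_two_inv
  have h2 : √2 ^ (-2 : ℤ) = 1 / 2 := by
    have := sqrt_two_zpow_add_two (-2)
    norm_num at this ⊢
  have h3 : √2 ^ (-3 : ℤ) = √2 / 4 := by
    have := sqrt_two_zpow_add_two (-3)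
    rw [show (-3 + 2 : ℤ) = -1 by norm_num, h1] at this
    linarith
  have h4 : √2 ^ (-4 : ℤ) = 1 / 4 := by
    have := sqrt_two_zpow_add_two (-4)
    rw [show (-4 + 2 : ℤ) = -2 by norm_num, h2] at this
    linarith
  have hs := sqrt_two_bounds
  by_cases h : Even k
  · simp only [fundamentalBrick, brickWidth, brickHeight, h, if_true]
    have e1 := hmono (show -k ≤ -2 by omega)
    have e2 := hmono (show -k - 1 ≤ -3 by omega)
    constructor <;> linarith
  · have hk3 : 3 ≤ k := by
      by_contra hlt
      exact h ⟨1, by omega⟩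
    simp only [fundamentalBrick, brickWidth, brickHeight, h, if_false]
    have e1 := hmono (show -k ≤ -3 by omega)
    have e2 := hmono (show -k - 1 ≤ -4 by omega)
    constructor <;> linarith

theorem corner_one (c : Bool) : (⟨0, [c]⟩ : DerivedBrick).toBrick.corner =
    (if c then 1 / 2 else 0, √2 / 2) := by
  cases c <;> simp [DerivedBrick.toBrick, Brick.split, fundamentalBrick_zero_corner,
    show (fundamentalBrick 0).level = 0 from rfl, brickWidth_one]

theorem corner_two (c d : Bool) : (⟨0, [c, d]⟩ : DerivedBrick).toBrick.corner =
    (if c then 1 / 2 else 0, if d then 3 * √2 / 4 else √2 / 2) := by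
  have h : (⟨0, [c, d]⟩ : DerivedBrick).toBrick = (⟨0, [c]⟩ : DerivedBrick).toBrick.split d := rfl
  have hl : (⟨0, [c]⟩ : DerivedBrick).toBrick.level = 1 := rfl
  rw [h]
  cases d <;> simp [Brick.split, hl, corner_one, brickHeight_two]
  ring

theorem corner_three (c d e : Bool) : (⟨0, [c, d, e]⟩ : DerivedBrick).toBrick.corner.1 =
    (if c then 1 / 2 else 0) + if e then 1 / 4 else 0 := by
  have h : (⟨0, [c, d, e]⟩ : DerivedBrick).toBrick =
    (⟨0, [c, d]⟩ : DerivedBrick).toBrick.split e := rfl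
  have hl : (⟨0, [c, d]⟩ : DerivedBrick).toBrick.level = 2 := rfl
  rw [h]
  cases e <;> simp [Brick.split, hl, corner_two, brickWidth_three]

theorem corner_root_one (c : Bool) : (⟨1, [c]⟩ : DerivedBrick).toBrick.corner.1 = 1 / 2 := by
  cases c <;> simp [DerivedBrick.toBrick, Brick.split, fundamentalBrick_one_corner,
    show (fundamentalBrick 1).level = 1 from rfl]

theorem corner_root_one_two (c d : Bool) : (⟨1, [c, d]⟩ : DerivedBrick).toBrick.corner.1 =
    1 / 2 + if d then 1 / 4 else 0 := by
  have h : (⟨1, [c, d]⟩ : DerivedBrick).toBrick = (⟨1, [c]⟩ : DerivedBrick).toBrick.split d := rfl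
  have hl : (⟨1, [c]⟩ : DerivedBrick).toBrick.level = 2 := rfl
  rw [h]
  cases d <;> simp [Brick.split, hl, corner_root_one, brickWidth_three]

theorem refines_of_eq {D : DerivedBrick} {r : ℤ} {p l : List Bool} (h : D = ⟨r, p ++ l⟩) :
    D.Refines ⟨r, p⟩ := by
  rw [h]; exact ⟨rfl, l, rfl⟩

section

variable {ι : Type*} [Fintype ι] {b : ι → DerivedBrick} {w h x y : ι → ℝ} {W H : ℝ}

theorem Layout.extent_brick (L : Layout b w h x y W H) (i : ι) :
    (b i).toBrick.corner.1 ≤ x i ∧ x i + w i ≤ (b i).toBrick.corner.1 + brickWidth (b i).level ∧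
    (b i).toBrick.corner.2 ≤ y i ∧
    y i + h i ≤ (b i).toBrick.corner.2 + brickHeight (b i).level := by
  by_cases hP : Even (b i).level
  · have h1 := L.even.le i hP
    have h2 := L.even.xpos i hP
    have h3 := L.even.ylow i hP
    have h4 := L.even.yhigh i hP
    have h5 := L.even.fits i hP
    refine ⟨?_, ?_, ?_, ?_⟩ <;> linarith
  · have h1 := L.odd.le i hP
    have h2 := L.odd.xpos i hP
    have h3 := L.odd.ylow i hP
    have h4 := L.odd.yhigh i hP
    have h5 := L.odd.fits i hP
    refine ⟨?_, ?_, ?_, ?_⟩ <;> linarith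

theorem Layout.extent (L : Layout b w h x y W H) {i : ι} {D : DerivedBrick}
    (hi : (b i).Refines D) :
    D.toBrick.corner.1 ≤ x i ∧ x i + w i ≤ D.toBrick.corner.1 + brickWidth D.level ∧
    D.toBrick.corner.2 ≤ y i ∧ y i + h i ≤ D.toBrick.corner.2 + brickHeight D.level := by
  have h1 := L.extent_brick i
  have h2 := hi.within
  have h3 := h2.left
  have h4 := h2.right
  have h5 := h2.bottom
  have h6 := h2.top
  rw [(b i).toBrick_level, D.toBrick_level] at h4 h6
  refine ⟨?_, ?_, ?_, ?_⟩ <;> linarith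

theorem Layout.extent_of_two_le_root (L : Layout b w h x y W H) {i : ι} (hi : 2 ≤ (b i).root) :
    x i + w i ≤ 1 / 2 ∧ y i + h i ≤ √2 / 2 := by
  have h1 := L.extent (i := i) (D := ⟨(b i).root, []⟩) ⟨rfl, List.nil_prefix⟩
  have h2 := fundamentalBrick_extent hi
  have h3 : (⟨(b i).root, []⟩ : DerivedBrick).toBrick = fundamentalBrick (b i).root := rfl
  have h4 : (⟨(b i).root, []⟩ : DerivedBrick).level = (b i).root := by simp [DerivedBrick.level]
  rw [h3, h4] at h1
  constructor <;> linarith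

theorem Layout.extent_of_root_eq_one (L : Layout b w h x y W H) {i : ι} (hi : (b i).root = 1) :
    1 / 2 ≤ x i ∧ x i + w i ≤ 1 ∧ y i + h i ≤ √2 / 2 := by
  have h1 := L.extent (i := i) (D := ⟨1, []⟩) ⟨hi, List.nil_prefix⟩
  have h3 : (⟨1, []⟩ : DerivedBrick).toBrick = fundamentalBrick 1 := rfl
  have h4 : (⟨1, []⟩ : DerivedBrick).level = 1 := by simp [DerivedBrick.level]
  rw [h3, h4, fundamentalBrick_one_corner, brickWidth_one, brickHeight_one] at h1
  simp only at h1
  refine ⟨?_, ?_, ?_⟩ <;> linarith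

theorem Layout.extent_of_root_eq_zero (L : Layout b w h x y W H) {i : ι} (hi : (b i).root = 0) :
    x i + w i ≤ 1 ∧ √2 / 2 ≤ y i ∧ y i + h i ≤ √2 := by
  have h1 := L.extent (i := i) (D := ⟨0, []⟩) ⟨hi, List.nil_prefix⟩
  have h3 : (⟨0, []⟩ : DerivedBrick).toBrick = fundamentalBrick 0 := rfl
  have h4 : (⟨0, []⟩ : DerivedBrick).level = 0 := by simp [DerivedBrick.level]
  rw [h3, h4, fundamentalBrick_zero_corner, brickWidth_zero, brickHeight_zero] at h1
  simp only at h1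
  refine ⟨?_, ?_, ?_⟩ <;> linarith

theorem Layout.right_le (L : Layout b w h x y W H) {i : ι} (hi : 0 ≤ (b i).root) :
    x i + w i ≤ 1 := by
  rcases (show (b i).root = 0 ∨ (b i).root = 1 ∨ 2 ≤ (b i).root by omega) with hr | hr | hr
  · exact (L.extent_of_root_eq_zero hr).1
  · exact (L.extent_of_root_eq_one hr).2.1
  · linarith [(L.extent_of_two_le_root hr).1]

theorem Layout.top_le_of_one_le_root (L : Layout b w h x y W H) {i : ι} (hi : 1 ≤ (b i).root) :
    y i + h i ≤ √2 / 2 := by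
  rcases (show (b i).root = 1 ∨ 2 ≤ (b i).root by omega) with hr | hr
  · exact (L.extent_of_root_eq_one hr).2.2
  · exact (L.extent_of_two_le_root hr).2

theorem Layout.top_le (L : Layout b w h x y W H) {i : ι} (hi : 0 ≤ (b i).root) :
    y i + h i ≤ √2 := by
  rcases (show (b i).root = 0 ∨ 1 ≤ (b i).root by omega) with hr | hr
  · exact (L.extent_of_root_eq_zero hr).2.2
  · linarith [L.top_le_of_one_le_root hr, sqrt_two_bounds.1]

theorem Layout.right_le_of_left_half (L : Layout b w h x y W H) {i : ι} {l : List Bool}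
    (hi : b i = ⟨0, false :: l⟩) : x i + w i ≤ 1 / 2 := by
  have h1 := L.extent (refines_of_eq (p := [false]) hi)
  have h4 : (⟨0, [false]⟩ : DerivedBrick).level = 1 := by simp [DerivedBrick.level]
  rw [h4, corner_one, brickWidth_one] at h1
  simp only [Bool.false_eq_true, if_false] at h1
  linarith

theorem Layout.top_le_of_lower_half (L : Layout b w h x y W H) {i : ι} {c : Bool} {l : List Bool}
    (hi : b i = ⟨0, c :: false :: l⟩) : y i + h i ≤ 3 * √2 / 4 := by
  have h1 := L.extent (refines_of_eq (p := [c, false]) hi)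
  have h4 : (⟨0, [c, false]⟩ : DerivedBrick).level = 2 := by simp [DerivedBrick.level]
  rw [h4, corner_two, brickHeight_two] at h1
  simp only [Bool.false_eq_true, if_false] at h1
  linarith

theorem Layout.right_le_of_third_split (L : Layout b w h x y W H) {i : ι} {c d : Bool}
    {l : List Bool} (hi : b i = ⟨0, c :: d :: false :: l⟩) : x i + w i ≤ 3 / 4 := by
  have h1 := L.extent (refines_of_eq (p := [c, d, false]) hi)
  have h4 : (⟨0, [c, d, false]⟩ : DerivedBrick).level = 3 := by simp [DerivedBrick.level]
  rw [h4, corner_three, brickWidth_three] at h1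
  simp only [Bool.false_eq_true, if_false] at h1
  split_ifs at h1 <;> linarith

theorem Layout.right_le_of_second_split (L : Layout b w h x y W H) {i : ι} {c : Bool}
    {l : List Bool} (hi : b i = ⟨1, c :: false :: l⟩) : x i + w i ≤ 3 / 4 := by
  have h1 := L.extent (refines_of_eq (p := [c, false]) hi)
  have h4 : (⟨1, [c, false]⟩ : DerivedBrick).level = 3 := by simp [DerivedBrick.level]
  rw [h4, corner_root_one_two, brickWidth_three] at h1
  simp only [Bool.false_eq_true, if_false] at h1
  linarith

theorem Layout.half_lt_of_level_zero (L : Layout b w h x y W H) {i : ι} (hi : (b i).level = 0) :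
    1 / 2 < w i := by
  have := L.even.wide i (by rw [hi]; decide)
  rw [hi, brickWidth_zero] at this
  linarith

theorem Layout.lt_of_level_one (L : Layout b w h x y W H) {i : ι} (hi : (b i).level = 1) :
    √2 / 4 < h i := by
  have := L.odd.wide i (by rw [hi]; decide)
  rw [hi, brickHeight_one] at this
  linarith

theorem Layout.lt_of_level_two (L : Layout b w h x y W H) {i : ι} (hi : (b i).level = 2) :
    1 / 4 < w i := by
  have := L.even.wide i (by rw [hi]; decide)
  rw [hi, brickWidth_two] at this
  linarith

/-- Pieces in a half of `B₀` stand on its lower edge. -/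
theorem Layout.top_of_half (L : Layout b w h x y W H) {i : ι} {c : Bool} (hi : b i = ⟨0, [c]⟩) :
    y i + h i = √2 / 2 + h i := by
  have := L.odd.xpos i (by rw [hi]; change ¬ Even (1 : ℤ); decide)
  rw [hi, corner_one] at this
  rw [this]

/-- Pieces in a brick of level `2` begin at its left edge, which is at most `1 / 2`. -/
theorem Layout.left_le_of_level_two (L : Layout b w h x y W H) {i : ι} (hi : (b i).level = 2)
    (hr : 0 ≤ (b i).root) : x i ≤ 1 / 2 := by
  rcases (show (b i).root = 0 ∨ (b i).root = 1 ∨ 2 ≤ (b i).root by omega) with h0 | h0 | h0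
  · have h1 := L.even.xpos i (by rw [hi]; decide)
    obtain ⟨c, d, hcd⟩ : ∃ c d, (b i).path = [c, d] := by
      rw [← List.length_eq_two]
      simp only [DerivedBrick.level, h0] at hi
      omega
    have hb : b i = ⟨0, [c, d]⟩ := DerivedBrick.ext h0 hcd
    rw [h1, hb, corner_two]
    cases c <;> simp
  · have h1 := L.even.xpos i (by rw [hi]; decide)
    obtain ⟨c, hc⟩ : ∃ c, (b i).path = [c] := by
      rw [← List.length_eq_one_iff]
      simp only [DerivedBrick.level, h0] at hi
      omega
    have hb : b i = ⟨1, [c]⟩ := DerivedBrick.ext h0 hc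
    rw [h1, hb, corner_root_one]
  · linarith [(L.extent_of_two_le_root h0).1, L.w_pos i]

/-- Pieces in the fundamental brick `B₁` fill it from the left. -/
theorem Layout.right_le_of_fundamental (L : Layout b w h x y W H) {i : ι} (hi : b i = ⟨1, []⟩) :
    x i + w i ≤ 1 / 2 + total b w ⟨1, []⟩ := by
  have h1 := L.odd.yhigh i (by rw [hi]; decide)
  have h3 : (⟨1, []⟩ : DerivedBrick).toBrick = fundamentalBrick 1 := rfl
  rw [hi, h3, fundamentalBrick_one_corner] at h1
  exact h1

theorem Layout.total_nonneg (L : Layout b w h x y W H) (D : DerivedBrick) : 0 ≤ total b w D :=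
  Finset.sum_nonneg fun i _ => (L.w_pos i).le

/-- Pieces in a brick of level `1` have height at least `√2 / 4`. -/
theorem Layout.total_le_levelArea (L : Layout b w h x y W H) {D : DerivedBrick}
    (hl : D.level = 1) (hr : 0 ≤ D.root) : √2 / 4 * total b w D ≤ levelArea b w h 1 := by
  classical
  have hsub : (Finset.univ.filter fun i => b i = D) ⊆
      Finset.univ.filter fun i => 0 ≤ (b i).root ∧ (b i).level = (1 : ℕ) := by
    intro i hi
    have hi' : b i = D := (Finset.mem_filter.1 hi).2
    exact Finset.mem_filter.2 ⟨Finset.mem_univ _, by rw [hi']; exact ⟨hr, by exact_mod_cast hl⟩⟩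
  rw [total, Finset.mul_sum]
  refine le_trans (Finset.sum_le_sum fun i hi => ?_) (Finset.sum_le_sum_of_subset_of_nonneg hsub
    fun i _ _ => (mul_pos (L.w_pos i) (L.h_pos i)).le)
  have hi' : b i = D := (Finset.mem_filter.1 hi).2
  have := L.lt_of_level_one (i := i) (by rw [hi', hl])
  rw [mul_comm (w i)]
  exact mul_le_mul_of_nonneg_right this.le (L.w_pos i).le

end

/-! ### The bound for normalized layouts -/

/-- A box of area at least `S` has half-perimeter at least `2 √S`; the constant is `4 * 3.96 ^ 2`.
-/
theorem le_of_sq_le_mul_area {T S W H : ℝ} (hWH : 0 ≤ W + H) (hS : S ≤ W * H)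
    (hT : T ^ 2 ≤ 62.7264 * S) : T ≤ 3.96 * (W + H) := by
  by_contra! hlt
  nlinarith [sq_nonneg (W - H), mul_nonneg hWH hWH]

section

variable {ι : Type*} [Fintype ι] {b : ι → DerivedBrick} {w h x y : ι → ℝ} {W H : ℝ}

theorem Layout.half_perimeter_nonneg (L : Layout b w h x y W H) (i : ι) : 0 ≤ W + H := by
  linarith [L.w_pos i, L.h_pos i, L.w_le i, L.h_le i]

/-- The positive quadrant up to the top right corner of `B₀` has half-perimeter `1 + √2`. If dense
bricks of total measure `5 / 8` are in use, then the area alone implies the bound. -/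
theorem Layout.bound_of_dense (L : Layout b w h x y W H) {i j : ι} {e : ℝ}
    (hi : 0 ≤ (b i).root) (hj : 0 ≤ (b j).root) (he : 5 / 8 ≤ e) (hS : √2 / 8 * e ≤ W * H) :
    x i + w i + (y j + h j) ≤ 3.96 * (W + H) := by
  have hs := sqrt_two_bounds
  refine le_trans (add_le_add (L.right_le hi) (L.top_le hj)) ?_
  refine le_of_sq_le_mul_area (L.half_perimeter_nonneg i) hS ?_
  nlinarith [sqrt_two_sq]

/-- If `B₀` itself is in use, then `W ≥ 1 / 2`, and the pieces in `B₀` reach up to a height `t`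
above its lower edge and have area at least `t / 2`. -/
theorem Layout.bound_of_fundamental (L : Layout b w h x y W H) {i j s : ι}
    (hi : 0 ≤ (b i).root) (hj : 0 ≤ (b j).root) (hs : b s = ⟨0, []⟩) :
    x i + w i + (y j + h j) ≤ 3.96 * (W + H) := by
  classical
  have hb := sqrt_two_bounds
  have hl : (⟨0, []⟩ : DerivedBrick).level = 0 := rfl
  have hW : 1 / 2 < W := (L.half_lt_of_level_zero (by rw [hs, hl])).trans_le (L.w_le s)
  set t := total b h ⟨0, []⟩ with ht
  have ht0 : 0 ≤ t := Finset.sum_nonneg fun q _ => (L.h_pos q).le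
  have ht1 : t ≤ √2 / 2 := by
    have := L.even.fits s (by rw [hs]; decide)
    rwa [hs, hl, brickHeight_zero] at this
  have hZ : y j + h j ≤ √2 / 2 + t := by
    rcases (show (b j).root = 0 ∨ 1 ≤ (b j).root by omega) with h0 | h0
    · have hjs : b j = ⟨0, []⟩ := by
        rw [← hs]
        exact L.eq_of_comparable j s (Or.inl (by rw [hs]; exact ⟨h0, List.nil_prefix⟩))
      have h1 := L.even.yhigh j (by rw [hjs]; decide)
      have h3 : (⟨0, []⟩ : DerivedBrick).toBrick = fundamentalBrick 0 := rfl
      rwa [hjs, h3, fundamentalBrick_zero_corner] at h1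
    · linarith [L.top_le_of_one_le_root h0]
  have hS : t / 2 ≤ W * H := by
    refine le_trans ?_ L.area_le
    refine le_trans ?_ (Finset.sum_le_sum_of_subset_of_nonneg
      (Finset.filter_subset (fun q => b q = ⟨0, []⟩) Finset.univ)
      fun q _ _ => (mul_pos (L.w_pos q) (L.h_pos q)).le)
    rw [ht, total, Finset.sum_div]
    refine Finset.sum_le_sum fun q hq => ?_
    have hq' : b q = ⟨0, []⟩ := (Finset.mem_filter.1 hq).2
    have := L.half_lt_of_level_zero (i := q) (by rw [hq', hl])
    nlinarith [L.h_pos q]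
  have hH : 0 < H := (L.h_pos s).trans_le (L.h_le s)
  have hX := L.right_le hi
  rcases le_or_gt 1 W with h1 | h1
  · linarith
  · nlinarith

theorem brick_eq_of_level_one {i j : ι} (h1 : (usedAt b 1).card ≤ 1)
    (hi : (b i).level = 1) (hi0 : 0 ≤ (b i).root) (hj : (b j).level = 1) (hj0 : 0 ≤ (b j).root) :
    b i = b j :=
  Finset.card_le_one.1 h1 _ (mem_usedAt.2 ⟨mem_usedBricks.2 ⟨⟨i, rfl⟩, hi0⟩, by exact_mod_cast hi⟩)
    _ (mem_usedAt.2 ⟨mem_usedBricks.2 ⟨⟨j, rfl⟩, hj0⟩, by exact_mod_cast hj⟩)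

theorem Layout.eq_of_refines (L : Layout b w h x y W H) {i j : ι} (hij : (b i).Refines (b j)) :
    b i = b j := L.eq_of_comparable i j (Or.inl hij)

/-- The dense area if no assumption is made on the bricks of level `2`. -/
theorem Layout.area_ge (L : Layout b w h x y W H) :
    levelArea b w h 1 + √2 / 8 * (deepMeasure b - 1 / 2) ≤ W * H := by
  have := L.levelArea_add_le_area (j₀ := 2) (fun j h1 h2 => by omega)
  norm_num at this ⊢
  exact this

theorem Layout.area_ge_of_card_ne_one (L : Layout b w h x y W H) (h2 : (usedAt b 2).card ≠ 1) :
    levelArea b w h 1 + √2 / 8 * (deepMeasure b - 1 / 4) ≤ W * H := by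
  have := L.levelArea_add_le_area (j₀ := 3) (fun j h1 h3 => by
    rw [show j = 2 by omega]; exact h2)
  norm_num at this ⊢
  exact this

theorem Layout.quarter_lt_width (L : Layout b w h x y W H) (h2 : (usedAt b 2).Nonempty) :
    1 / 4 < W := by
  obtain ⟨D, hD⟩ := h2
  obtain ⟨hDu, hl⟩ := mem_usedAt.1 hD
  obtain ⟨⟨q, rfl⟩, -⟩ := mem_usedBricks.1 hDu
  exact (L.lt_of_level_two (by exact_mod_cast hl)).trans_le (L.w_le q)

/-- The right half of `B₀` is in use as a brick of level `1`. -/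
theorem Layout.bound_of_right_half (L : Layout b w h x y W H) {i j s : ι}
    (h0 : ∀ D ∈ usedBricks b, D.level ≠ 0) (h1 : (usedAt b 1).card ≤ 1)
    (hi : 0 ≤ (b i).root) (hj : 0 ≤ (b j).root) (hs : b s = ⟨0, [true]⟩) :
    x i + w i + (y j + h j) ≤ 3.96 * (W + H) := by
  have hb := sqrt_two_bounds
  have hU := L.le_deepMeasure_add_half (i := s) (r := 0) (p := [true]) h0 h1
    (refines_of_eq (l := []) hs)
  norm_num at hU
  have hA := L.levelArea_nonneg 1
  have hsl : (b s).level = 1 := by rw [hs]; rfl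
  by_cases h2 : (usedAt b 2).card = 1
  · have hW := L.quarter_lt_width (Finset.card_pos.1 (by omega))
    have hhs := L.lt_of_level_one hsl
    have hH := L.h_le s
    have hX := L.right_le hi
    by_cases hZ : y j + h j ≤ 3 * √2 / 4
    · linarith
    · rcases (show (b j).root = 0 ∨ 1 ≤ (b j).root by omega) with hr | hr
      · obtain ⟨p, hp⟩ : ∃ p, b j = ⟨0, p⟩ := ⟨(b j).path, DerivedBrick.ext hr rfl⟩
        rcases p with _ | ⟨c, l⟩
        · exact absurd (by rw [hp]; rfl) (h0 (b j) (mem_usedBricks.2 ⟨⟨j, rfl⟩, hj⟩))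
        · cases c
          · rcases l with _ | ⟨d, l⟩
            · have := brick_eq_of_level_one h1 (i := j) (j := s) (by rw [hp]; rfl) hj hsl
                (by rw [hs])
              rw [hp, hs] at this
              simp at this
            · cases d
              · exact absurd (L.top_le_of_lower_half hp) hZ
              · have hU' := L.le_deepMeasure (i := j) (r := 0) (p := [false, true]) h0
                  (refines_of_eq hp) (by
                    intro D hD
                    obtain ⟨hDu, hDl⟩ := mem_usedAt.1 hD
                    obtain ⟨⟨q, rfl⟩, hqr⟩ := mem_usedBricks.1 hDu
                    rw [brick_eq_of_level_one h1 (by exact_mod_cast hDl) hqr hsl (by rw [hs]), hs]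
                    simp [DerivedBrick.code])
                norm_num at hU'
                refine L.bound_of_dense (e := deepMeasure b - 1 / 2) hi hj (by linarith) ?_
                linarith [L.area_ge]
          · have hjs : b j = ⟨0, [true]⟩ := by
              rw [← hs]
              exact L.eq_of_refines (by rw [hs]; exact refines_of_eq (p := [true]) hp)
            have := L.top_of_half hjs
            have hhj := L.lt_of_level_one (i := j) (by rw [hjs]; rfl)
            have := L.h_le j
            linarith
      · exact absurd ((L.top_le_of_one_le_root hr).trans (by linarith)) hZ
  · refine L.bound_of_dense (e := deepMeasure b - 1 / 4) hi hj (by linarith) ?_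
    linarith [L.area_ge_of_card_ne_one h2]

/-- A brick of level at least `2` is in use in the right half of `B₀`. -/
theorem Layout.bound_of_in_right_half (L : Layout b w h x y W H) {i j s : ι} {c : Bool}
    {l : List Bool} (h0 : ∀ D ∈ usedBricks b, D.level ≠ 0) (h1 : (usedAt b 1).card ≤ 1)
    (hi : 0 ≤ (b i).root) (hj : 0 ≤ (b j).root) (hs : b s = ⟨0, true :: c :: l⟩) :
    x i + w i + (y j + h j) ≤ 3.96 * (W + H) := by
  have hb := sqrt_two_bounds
  have hsr : (b s).Refines ⟨0, [true]⟩ := refines_of_eq (p := [true]) hs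
  have hU := L.le_deepMeasure_add_half (i := s) (r := 0) (p := [true]) h0 h1 hsr
  norm_num at hU
  have hA := L.levelArea_nonneg 1
  -- Without a brick of level `1`, everything in use is of level at least `2`.
  by_cases hone : ∃ q, (b q).level = 1 ∧ 0 ≤ (b q).root
  swap
  · have hU' := L.le_deepMeasure (i := s) (r := 0) (p := [true]) h0 hsr (by
      intro D hD
      obtain ⟨hDu, hDl⟩ := mem_usedAt.1 hD
      obtain ⟨⟨q, rfl⟩, hqr⟩ := mem_usedBricks.1 hDu
      exact absurd ⟨q, by exact_mod_cast hDl, hqr⟩ hone)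
    norm_num at hU'
    refine L.bound_of_dense (e := deepMeasure b - 1 / 2) hi hj (by linarith) ?_
    linarith [L.area_ge]
  obtain ⟨q, hql, hqr⟩ := hone
  by_cases h2 : (usedAt b 2).card = 1
  swap
  · refine L.bound_of_dense (e := deepMeasure b - 1 / 4) hi hj (by linarith) ?_
    linarith [L.area_ge_of_card_ne_one h2]
  have hW := L.quarter_lt_width (Finset.card_pos.1 (by omega))
  have hH := (L.lt_of_level_one hql).trans_le (L.h_le q)
  have hX := L.right_le hi
  have hZ := L.top_le hj
  -- If the box is not nearly tight for its width, its height and its area, then it is large enough.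
  by_cases htight : 0.61 ≤ W + H
  · linarith
  have harea : W * H ≤ 0.093026 := by nlinarith [sq_nonneg (W - H)]
  have hfill : ∀ D : DerivedBrick, D.level = 1 → 0 ≤ D.root → total b w D ≤ 0.02 := by
    intro D hl hr
    have e1 := L.total_le_levelArea hl hr
    have e2 := L.area_ge
    nlinarith [L.total_nonneg D]
  by_cases hX' : x i + w i ≤ 0.95
  · linarith
  have hwi := L.w_le i
  -- So piece `i` reaches far to the right although it is narrow, and its brick lies at the right.
  have hU3 : ∀ d l', b i = ⟨0, true :: d :: true :: l'⟩ →
      x i + w i + (y j + h j) ≤ 3.96 * (W + H) := by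
    intro d l' hbi
    have hU' := L.le_deepMeasure_add_half (i := i) (r := 0) (p := [true, d, true]) h0 h1
      (refines_of_eq hbi)
    have hU'' : 9 / 8 ≤ deepMeasure b := by
      cases d <;> norm_num at hU' <;> linarith
    refine L.bound_of_dense (e := deepMeasure b - 1 / 2) hi hj (by linarith) ?_
    linarith [L.area_ge]
  obtain ⟨r, p, hp⟩ : ∃ r p, b i = ⟨r, p⟩ := ⟨(b i).root, (b i).path, rfl⟩
  have hnot2 : (b i).level ≠ 2 := fun hl => by
    have := L.left_le_of_level_two hl hi
    linarith
  rcases (show r = 0 ∨ r = 1 ∨ 2 ≤ r by rw [hp] at hi; simp only at hi; omega) with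
    rfl | rfl | hr
  · rcases p with _ | ⟨c₁, _ | ⟨c₂, _ | ⟨c₃, l'⟩⟩⟩
    · exact absurd (by rw [hp]; rfl) (h0 (b i) (mem_usedBricks.2 ⟨⟨i, rfl⟩, hi⟩))
    · cases c₁
      · linarith [L.right_le_of_left_half hp]
      · have := L.eq_of_refines (i := s) (j := i) (by rw [hp]; exact hsr)
        rw [hs, hp] at this
        simp at this
    · exact absurd (by rw [hp]; rfl) hnot2
    · cases c₁
      · linarith [L.right_le_of_left_half hp]
      · cases c₃
        · linarith [L.right_le_of_third_split hp]
        · exact hU3 _ _ hp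
  · rcases p with _ | ⟨c₁, _ | ⟨c₂, l'⟩⟩
    · have e1 := L.right_le_of_fundamental hp
      have e2 := hfill ⟨1, []⟩ rfl (by simp)
      linarith
    · exact absurd (by rw [hp]; rfl) hnot2
    · cases c₂
      · linarith [L.right_le_of_second_split hp]
      · -- Here piece `i` lies in `B₁`, and piece `j` has to lie at the top of `B₀`.
        by_cases hZ' : y j + h j ≤ 1.3
        · linarith
        have hhj := L.h_le j
        have hjr : (b j).root = 0 := by
          by_contra hne
          linarith [L.top_le_of_one_le_root (i := j) (by omega)]
        obtain ⟨p', hp'⟩ : ∃ p', b j = ⟨0, p'⟩ := ⟨(b j).path, DerivedBrick.ext hjr rfl⟩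
        rcases p' with _ | ⟨d₁, _ | ⟨d₂, l''⟩⟩
        · exact absurd (by rw [hp']; rfl) (h0 (b j) (mem_usedBricks.2 ⟨⟨j, rfl⟩, hj⟩))
        · linarith [L.top_of_half hp']
        · cases d₂
          · linarith [L.top_le_of_lower_half hp']
          · cases d₁
            · -- Each of the three places for a brick of level `1` is taken by shorter bricks.
              exfalso
              obtain ⟨r, p, hq⟩ : ∃ r p, b q = ⟨r, p⟩ := ⟨(b q).root, (b q).path, rfl⟩
              rw [hq] at hql hqr
              simp only [DerivedBrick.level] at hql hqr
              rcases p with _ | ⟨e₁, _ | ⟨e₂, m⟩⟩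
              · have hr1 : r = 1 := by simpa using hql
                subst hr1
                have := L.eq_of_refines (i := i) (j := q)
                  (by rw [hq]; exact refines_of_eq (p := []) hp)
                rw [hp, hq] at this
                simp at this
              · have hr0 : r = 0 := by simpa using hql
                subst hr0
                cases e₁
                · have := L.eq_of_refines (i := j) (j := q)
                    (by rw [hq]; exact refines_of_eq (p := [false]) hp')
                  rw [hp', hq] at this
                  simp at this
                · have := L.eq_of_refines (i := s) (j := q) (by rw [hq]; exact hsr)
                  rw [hs, hq] at this
                  simp at this
              · simp only [List.length_cons] at hql
                omega
            · have hU' := L.le_deepMeasure_add_half (i := j) (r := 0) (p := [true, true]) h0 h1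
                (refines_of_eq hp')
              norm_num at hU'
              refine L.bound_of_dense (e := deepMeasure b - 1 / 2) hi hj (by linarith) ?_
              linarith [L.area_ge]
  · linarith [(L.extent_of_two_le_root (i := i) (by rw [hp]; exact hr)).1]

/-- The top of a piece outside the upper part of `B₀†1` and outside `B₀†2`. -/
theorem Layout.top_le_of_left_half (L : Layout b w h x y W H) {j : ι} (hj : 0 ≤ (b j).root)
    (h0 : ∀ D ∈ usedBricks b, D.level ≠ 0) (hjr : ∀ l, b j ≠ ⟨0, true :: l⟩)
    (hj1 : b j ≠ ⟨0, [false]⟩) (hj2 : ∀ l, b j ≠ ⟨0, false :: true :: l⟩) :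
    y j + h j ≤ 3 * √2 / 4 := by
  rcases (show (b j).root = 0 ∨ 1 ≤ (b j).root by omega) with hr | hr
  · obtain ⟨p, hp⟩ : ∃ p, b j = ⟨0, p⟩ := ⟨(b j).path, DerivedBrick.ext hr rfl⟩
    rcases p with _ | ⟨c, _ | ⟨d, l⟩⟩
    · exact absurd (by rw [hp]; rfl) (h0 (b j) (mem_usedBricks.2 ⟨⟨j, rfl⟩, hj⟩))
    · cases c
      · exact absurd hp hj1
      · exact absurd hp (hjr _)
    · cases d
      · exact L.top_le_of_lower_half hp
      · cases c
        · exact absurd hp (hj2 _)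
        · exact absurd hp (hjr _)
  · linarith [L.top_le_of_one_le_root hr, sqrt_two_bounds.1]

/-- Piece `s` lies in the left half of `B₀`, piece `j` does not lie in the right half, and neither
`B₁` nor the left half of `B₀` is in use as a brick of level `1`. -/
theorem Layout.bound_of_in_left_half (L : Layout b w h x y W H) {i j s : ι} {l : List Bool}
    (h0 : ∀ D ∈ usedBricks b, D.level ≠ 0)
    (hi : 0 ≤ (b i).root) (hj : 0 ≤ (b j).root) (hs : b s = ⟨0, false :: l⟩)
    (hjr : ∀ l, b j ≠ ⟨0, true :: l⟩)
    (hB1 : ∀ q, b q ≠ ⟨1, []⟩) (hB0 : ∀ q, b q ≠ ⟨0, [false]⟩) :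
    x i + w i + (y j + h j) ≤ 3.96 * (W + H) := by
  have hb := sqrt_two_bounds
  have hA := L.levelArea_nonneg 1
  have hcode : ∀ D ∈ usedAt b 1, 3 ≤ D.code := by
    intro D hD
    obtain ⟨hDu, hDl⟩ := mem_usedAt.1 hD
    obtain ⟨⟨q, rfl⟩, hqr⟩ := mem_usedBricks.1 hDu
    obtain ⟨r, p, hq⟩ : ∃ r p, b q = ⟨r, p⟩ := ⟨(b q).root, (b q).path, rfl⟩
    rw [hq] at hDl hqr
    simp only [DerivedBrick.level] at hDl hqr
    rcases p with _ | ⟨e₁, _ | ⟨e₂, m⟩⟩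
    · have hr1 : r = 1 := by simpa using hDl
      subst hr1
      exact absurd hq (hB1 q)
    · have hr0 : r = 0 := by simpa using hDl
      subst hr0
      cases e₁
      · exact absurd hq (hB0 q)
      · rw [hq]; simp [DerivedBrick.code]
    · simp only [List.length_cons] at hDl
      omega
  have hupper : ∀ t l', b t = ⟨0, false :: true :: l'⟩ →
      x i + w i + (y j + h j) ≤ 3.96 * (W + H) := by
    intro t l' ht
    have hU := L.le_deepMeasure (i := t) (r := 0) (p := [false, true]) h0 (refines_of_eq ht)
      (fun D hD => by have := hcode D hD; simp; omega)
    norm_num at hU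
    refine L.bound_of_dense (e := deepMeasure b - 1 / 2) hi hj (by linarith) ?_
    linarith [L.area_ge]
  rcases l with _ | ⟨_ | _, l⟩
  · exact absurd hs (hB0 s)
  · by_cases hj2 : ∃ l', b j = ⟨0, false :: true :: l'⟩
    · obtain ⟨l', hl'⟩ := hj2
      exact hupper j l' hl'
    · push Not at hj2
      have hU := L.le_deepMeasure (i := s) (r := 0) (p := [false, false]) h0 (refines_of_eq hs)
        (fun D hD => by have := hcode D hD; simp; omega)
      norm_num at hU
      refine (add_le_add (L.right_le hi) (L.top_le_of_left_half hj h0 hjr (hB0 j) hj2)).trans ?_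
      refine le_of_sq_le_mul_area (S := √2 / 16) (L.half_perimeter_nonneg i) ?_ ?_
      · nlinarith [L.area_ge]
      · nlinarith [sqrt_two_sq]
  · exact hupper s l hs

/-- The left half of `B₀` is in use as a brick of level `1`. -/
theorem Layout.bound_of_left_half (L : Layout b w h x y W H) {i j s : ι}
    (h0 : ∀ D ∈ usedBricks b, D.level ≠ 0) (h1 : (usedAt b 1).card ≤ 1)
    (hi : 0 ≤ (b i).root) (hj : 0 ≤ (b j).root) (hs : b s = ⟨0, [false]⟩)
    (hir : ∀ l, b i ≠ ⟨0, true :: l⟩) (hjr : ∀ l, b j ≠ ⟨0, true :: l⟩) :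
    x i + w i + (y j + h j) ≤ 3.96 * (W + H) := by
  have hb := sqrt_two_bounds
  have hA := L.levelArea_nonneg 1
  have hsl : (b s).level = 1 := by rw [hs]; rfl
  -- The height `t` of some piece of level `1` bounds how far the layout reaches into `B₀`.
  obtain ⟨t, ht0, htH, hZ⟩ : ∃ t, √2 / 4 < t ∧ t ≤ H ∧ y j + h j ≤ √2 / 2 + t := by
    by_cases hjs : b j = ⟨0, [false]⟩
    · exact ⟨h j, L.lt_of_level_one (by rw [hjs]; rfl), L.h_le j, (L.top_of_half hjs).le⟩
    · refine ⟨h s, L.lt_of_level_one hsl, L.h_le s, ?_⟩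
      rcases (show (b j).root = 0 ∨ 1 ≤ (b j).root by omega) with hr | hr
      · obtain ⟨p, hp⟩ : ∃ p, b j = ⟨0, p⟩ := ⟨(b j).path, DerivedBrick.ext hr rfl⟩
        rcases p with _ | ⟨_ | _, l⟩
        · exact absurd (by rw [hp]; rfl) (h0 (b j) (mem_usedBricks.2 ⟨⟨j, rfl⟩, hj⟩))
        · refine absurd ?_ hjs
          rw [← hs]
          exact L.eq_of_refines (by rw [hs]; exact refines_of_eq (p := [false]) hp)
        · exact absurd hp (hjr _)
      · linarith [L.top_le_of_one_le_root hr, L.h_pos s]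
  have hX := L.right_le hi
  rcases (usedAt b 2).eq_empty_or_nonempty with h2 | h2
  swap
  · have hW := L.quarter_lt_width h2
    linarith
  have h2' : (usedAt b 2).card ≠ 1 := by simp [h2]
  have hnot2 : ∀ q, 0 ≤ (b q).root → (b q).level ≠ 2 := fun q hq hl => by
    have : b q ∈ usedAt b 2 := mem_usedAt.2 ⟨mem_usedBricks.2 ⟨⟨q, rfl⟩, hq⟩, by exact_mod_cast hl⟩
    rw [h2] at this
    simp at this
  have hcode : ∀ D ∈ usedAt b 1, D.code = 2 := by
    intro D hD
    obtain ⟨hDu, hDl⟩ := mem_usedAt.1 hD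
    obtain ⟨⟨q, rfl⟩, hqr⟩ := mem_usedBricks.1 hDu
    rw [brick_eq_of_level_one h1 (by exact_mod_cast hDl) hqr hsl (by rw [hs]), hs]
    rfl
  have hB1 : ∀ q, b q ≠ ⟨1, []⟩ := fun q hq => by
    have := brick_eq_of_level_one h1 (i := q) (j := s) (by rw [hq]; rfl) (by rw [hq]; simp) hsl
      (by rw [hs])
    rw [hq, hs] at this
    simp at this
  -- The brick `B₁` precedes the left half of `B₀`, so it is in use as well.
  obtain ⟨q, hq⟩ := L.exists_comparable s ⟨1, []⟩ (by rw [hs]; rfl) (by rw [hs]; decide)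
  have hqr : (b q).Refines ⟨1, []⟩ := by
    rcases hq with hq | hq
    · refine absurd (DerivedBrick.ext hq.1.symm ?_) (hB1 q)
      exact List.prefix_nil.1 hq.2
    · exact hq
  have hU := L.le_deepMeasure (i := q) (r := 1) (p := []) h0 hqr
    (fun D hD => by rw [hcode D hD]; simp)
  norm_num at hU
  have hS := L.area_ge_of_card_ne_one h2'
  have hH0 : 0 < H := by linarith
  by_cases hX' : x i + w i ≤ 3 / 4
  · have hWH : √2 / 32 ≤ W * H := by nlinarith
    -- Subject to these bounds, `W + H` is least at `H = t = √2 / 4`, about `0.36`.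
    have : (1.4572 + t) ≤ 3.96 * (W + H) := by
      nlinarith [sq_nonneg (H - 0.36), mul_pos hH0 hH0]
    linarith
  · obtain ⟨r, p, hp⟩ : ∃ r p, b i = ⟨r, p⟩ := ⟨(b i).root, (b i).path, rfl⟩
    rcases (show r = 0 ∨ r = 1 ∨ 2 ≤ r by rw [hp] at hi; simp only at hi; omega) with
      rfl | rfl | hr
    · rcases p with _ | ⟨_ | _, l'⟩
      · exact absurd (by rw [hp]; rfl) (h0 (b i) (mem_usedBricks.2 ⟨⟨i, rfl⟩, hi⟩))
      · linarith [L.right_le_of_left_half hp]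
      · exact absurd hp (hir _)
    · rcases p with _ | ⟨c₁, _ | ⟨c₂, l'⟩⟩
      · exact absurd hp (hB1 i)
      · exact absurd (by rw [hp]; rfl) (hnot2 i hi)
      · cases c₂
        · exact absurd (L.right_le_of_second_split hp) hX'
        · have hU' := L.le_deepMeasure (i := i) (r := 1) (p := [c₁, true]) h0 (refines_of_eq hp)
            (fun D hD => by rw [hcode D hD]; cases c₁ <;> simp)
          have hU'' : 5 / 8 ≤ deepMeasure b := by
            cases c₁ <;> norm_num at hU' <;> linarith
          have hWH : 3 * √2 / 64 ≤ W * H := by nlinarith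
          have : (1.7072 + t) ≤ 3.96 * (W + H) := by
            nlinarith [sq_nonneg (H - 0.36), mul_pos hH0 hH0]
          linarith
    · linarith [(L.extent_of_two_le_root (i := i) (by rw [hp]; exact hr)).1]

/-- `B₁` is in use as a brick of level `1`, and piece `s` lies in the left half of `B₀`. -/
theorem Layout.bound_of_fundamental_one (L : Layout b w h x y W H) {i j s q : ι} {l : List Bool}
    (h0 : ∀ D ∈ usedBricks b, D.level ≠ 0) (h1 : (usedAt b 1).card ≤ 1)
    (hi : 0 ≤ (b i).root) (hj : 0 ≤ (b j).root) (hs : b s = ⟨0, false :: l⟩)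
    (hq : b q = ⟨1, []⟩)
    (hir : ∀ l, b i ≠ ⟨0, true :: l⟩) (hjr : ∀ l, b j ≠ ⟨0, true :: l⟩) :
    x i + w i + (y j + h j) ≤ 3.96 * (W + H) := by
  have hb := sqrt_two_bounds
  have hql : (b q).level = 1 := by rw [hq]; rfl
  have hB0 : ∀ t, b t ≠ ⟨0, [false]⟩ := fun t ht => by
    have := brick_eq_of_level_one h1 (i := t) (j := q) (by rw [ht]; rfl) (by rw [ht]) hql
      (by rw [hq]; simp)
    rw [ht, hq] at this
    simp at this
  -- The total width `t` in `B₁` bounds the right end of the layout and contributes to the area.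
  set t := total b w ⟨1, []⟩ with ht
  have ht0 : 0 ≤ t := L.total_nonneg _
  have hA : √2 / 4 * t ≤ levelArea b w h 1 := L.total_le_levelArea rfl (by simp)
  have ht1 : t ≤ 1 / 2 := by
    have := L.odd.fits q (by rw [hq]; decide)
    rwa [hq, show (⟨1, []⟩ : DerivedBrick).level = 1 from rfl, brickWidth_one] at this
  have hX : x i + w i ≤ 1 / 2 + t := by
    obtain ⟨r, p, hp⟩ : ∃ r p, b i = ⟨r, p⟩ := ⟨(b i).root, (b i).path, rfl⟩
    rcases (show r = 0 ∨ r = 1 ∨ 2 ≤ r by rw [hp] at hi; simp only at hi; omega) with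
      rfl | rfl | hr
    · rcases p with _ | ⟨_ | _, l'⟩
      · exact absurd (by rw [hp]; rfl) (h0 (b i) (mem_usedBricks.2 ⟨⟨i, rfl⟩, hi⟩))
      · linarith [L.right_le_of_left_half hp]
      · exact absurd hp (hir _)
    · refine L.right_le_of_fundamental ?_
      rw [← hq]
      exact L.eq_of_refines (by rw [hq, hp]; exact ⟨rfl, List.nil_prefix⟩)
    · linarith [(L.extent_of_two_le_root (i := i) (by rw [hp]; exact hr)).1]
  have hZ := L.top_le hj
  have hH := (L.lt_of_level_one hql).trans_le (L.h_le q)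
  have hWH0 := L.half_perimeter_nonneg i
  have hlower : 1 / 2 ≤ deepMeasure b := by
    rcases l with _ | ⟨_ | _, l⟩
    · exact absurd hs (hB0 s)
    · have hU := L.le_deepMeasure_add_half (i := s) (r := 0) (p := [false, false]) h0 h1
        (refines_of_eq hs)
      norm_num at hU
      linarith
    · have hU := L.le_deepMeasure_add_half (i := s) (r := 0) (p := [false, true]) h0 h1
        (refines_of_eq hs)
      norm_num at hU
      linarith
  rcases (usedAt b 2).eq_empty_or_nonempty with h2 | h2
  swap
  · have hW := L.quarter_lt_width h2
    by_cases ht2 : t ≤ 2 / 5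
    · linarith
    · refine le_trans (add_le_add hX hZ) (le_of_sq_le_mul_area (S := √2 / 10) hWH0 ?_ ?_)
      · nlinarith [L.area_ge]
      · nlinarith [sqrt_two_sq]
  have hS := L.area_ge_of_card_ne_one (by simp [h2])
  by_cases hj2 : ∃ l', b j = ⟨0, false :: true :: l'⟩
  · obtain ⟨l', hl'⟩ := hj2
    have hU := L.le_deepMeasure_add_half (i := j) (r := 0) (p := [false, true]) h0 h1
      (refines_of_eq hl')
    norm_num at hU
    refine le_trans (add_le_add hX hZ)
      (le_of_sq_le_mul_area (S := √2 / 4 * t + √2 / 16) hWH0 ?_ ?_)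
    · nlinarith
    · nlinarith [sqrt_two_sq]
  · push Not at hj2
    have hZ' := L.top_le_of_left_half hj h0 hjr (hB0 j) hj2
    refine le_trans (add_le_add hX hZ')
      (le_of_sq_le_mul_area (S := √2 / 4 * t + √2 / 32) hWH0 ?_ ?_)
    · nlinarith
    · nlinarith [sqrt_two_sq]

/-- The bound when `B₀` is the largest fundamental brick that contains piece `i` or piece `j`. The
cases distinguish whether `B₀` is in use as a whole, whether one of the two pieces lies in its
right half, and which brick of level `1` is in use. -/
theorem Layout.bound_normalized (L : Layout b w h x y W H) {i j : ι} (hi : 0 ≤ (b i).root)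
    (hj : 0 ≤ (b j).root) (hij : (b i).root = 0 ∨ (b j).root = 0) :
    x i + w i + (y j + h j) ≤ 3.96 * (W + H) := by
  have hb := sqrt_two_bounds
  by_cases h0 : ∀ D ∈ usedBricks b, D.level ≠ 0
  swap
  · push Not at h0
    obtain ⟨D, hD, hl⟩ := h0
    obtain ⟨⟨s, rfl⟩, hr⟩ := mem_usedBricks.1 hD
    refine L.bound_of_fundamental (s := s) hi hj ?_
    simp only [DerivedBrick.level] at hl
    exact DerivedBrick.ext (by simp only; omega)
      (List.length_eq_zero_iff.1 (by omega))
  by_cases h1 : (usedAt b 1).card ≤ 1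
  swap
  · have hA := L.card_mul_le_levelArea (j := 1) (by omega)
    have hc : (2 : ℝ) ≤ (usedAt b 1).card := by exact_mod_cast not_le.1 h1
    have hle : levelArea b w h 1 ≤ W * H := by
      refine le_trans (Finset.sum_le_sum_of_subset_of_nonneg (Finset.filter_subset _ _)
        fun q _ _ => (mul_pos (L.w_pos q) (L.h_pos q)).le) L.area_le
    refine L.bound_of_dense (e := 1) hi hj (by norm_num) ?_
    nlinarith
  by_cases hright : ∃ s l, (s = i ∨ s = j) ∧ b s = ⟨0, true :: l⟩
  · obtain ⟨s, l, -, hs⟩ := hright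
    rcases l with _ | ⟨c, l⟩
    · exact L.bound_of_right_half h0 h1 hi hj hs
    · exact L.bound_of_in_right_half h0 h1 hi hj hs
  push Not at hright
  have hir : ∀ l, b i ≠ ⟨0, true :: l⟩ := fun l => hright i l (Or.inl rfl)
  have hjr : ∀ l, b j ≠ ⟨0, true :: l⟩ := fun l => hright j l (Or.inr rfl)
  obtain ⟨s, l, hs⟩ : ∃ s l, b s = ⟨0, false :: l⟩ := by
    have key : ∀ s, (b s).root = 0 → (∀ l, b s ≠ ⟨0, true :: l⟩) →
        ∃ s l, b s = ⟨0, false :: l⟩ := by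
      intro s hr hne
      obtain ⟨p, hp⟩ : ∃ p, b s = ⟨0, p⟩ := ⟨(b s).path, DerivedBrick.ext hr rfl⟩
      rcases p with _ | ⟨_ | _, l⟩
      · exact absurd (by rw [hp]; rfl) (h0 (b s) (mem_usedBricks.2 ⟨⟨s, rfl⟩, hr.ge⟩))
      · exact ⟨s, l, hp⟩
      · exact absurd hp (hne l)
    rcases hij with hr | hr
    · exact key i hr hir
    · exact key j hr hjr
  by_cases hB0 : ∃ q, b q = ⟨0, [false]⟩
  · obtain ⟨q, hq⟩ := hB0
    exact L.bound_of_left_half h0 h1 hi hj hq hir hjr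
  by_cases hB1 : ∃ q, b q = ⟨1, []⟩
  · obtain ⟨q, hq⟩ := hB1
    exact L.bound_of_fundamental_one h0 h1 hi hj hs hq hir hjr
  push Not at hB0 hB1
  exact L.bound_of_in_left_half h0 hi hj hs hjr hB1 hB0

theorem Layout.bound (L : Layout b w h x y W H) (i j : ι) :
    x i + w i + (y j + h j) ≤ 3.96 * (W + H) :=
  L.bound_of_normalized (fun _ _ _ _ _ _ _ L _ _ hi hj hij => L.bound_normalized hi hj hij) i j

end

/-! ### Bounding boxes -/

theorem isCompact_iUnion_region (P : List PlacedPiece) : IsCompact (⋃ q ∈ P, q.region) :=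
  (List.finite_toSet P).isCompact_biUnion fun _ _ => isCompact_Icc.prod isCompact_Icc

theorem corner_mem_region (q : PlacedPiece) : q.pos ∈ q.region :=
  ⟨⟨le_rfl, by linarith [q.piece.width_pos]⟩, ⟨le_rfl, by linarith [q.piece.height_pos]⟩⟩

theorem opposite_corner_mem_region (q : PlacedPiece) :
    (q.pos.1 + q.piece.width, q.pos.2 + q.piece.height) ∈ q.region :=
  ⟨⟨by simp [q.piece.width_pos.le], le_rfl⟩, ⟨by simp [q.piece.height_pos.le], le_rfl⟩⟩

/-- The interior of a placed piece has the area of the piece. -/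
theorem volume_interior_region (q : PlacedPiece) :
    MeasureTheory.volume (interior q.region) =
      ENNReal.ofReal (q.piece.width * q.piece.height) := by
  rw [PlacedPiece.region, interior_rectangle, MeasureTheory.Measure.volume_eq_prod,
    MeasureTheory.Measure.prod_prod, Real.volume_Ioo, Real.volume_Ioo,
    ← ENNReal.ofReal_mul (by linarith [q.piece.width_pos])]
  congr 1
  ring

/-- A packing fits in a box whose half-perimeter is half its cost. In particular, that box is at
least as wide and as high as each piece, and its area is at least the total area. -/
theorem IsPacking.exists_box {L : List Piece} {Q : List PlacedPiece} (hQ : IsPacking L Q)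
    (hL : L ≠ []) : ∃ W H : ℝ, cost Q = 2 * (W + H) ∧ (∀ p ∈ L, p.width ≤ W) ∧
      (∀ p ∈ L, p.height ≤ H) ∧ (L.map fun p => p.width * p.height).sum ≤ W * H := by
  set U := ⋃ q ∈ Q, q.region with hU
  have hcomp : IsCompact U := isCompact_iUnion_region Q
  have hc1 := hcomp.image continuous_fst
  have hc2 := hcomp.image continuous_snd
  have hsub : ∀ q ∈ Q, q.region ⊆ U := fun q hq => Set.subset_biUnion_of_mem (u := fun q =>
    PlacedPiece.region q) hq
  have hbox : ∀ q ∈ Q, sInf (Prod.fst '' U) ≤ q.pos.1 ∧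
      q.pos.1 + q.piece.width ≤ sSup (Prod.fst '' U) ∧ sInf (Prod.snd '' U) ≤ q.pos.2 ∧
      q.pos.2 + q.piece.height ≤ sSup (Prod.snd '' U) := by
    intro q hq
    have h1 := hsub q hq (corner_mem_region q)
    have h2 := hsub q hq (opposite_corner_mem_region q)
    exact ⟨csInf_le hc1.bddBelow ⟨_, h1, rfl⟩, le_csSup hc1.bddAbove ⟨_, h2, rfl⟩,
      csInf_le hc2.bddBelow ⟨_, h1, rfl⟩, le_csSup hc2.bddAbove ⟨_, h2, rfl⟩⟩
  set l := sInf (Prod.fst '' U) with hl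
  set r := sSup (Prod.fst '' U) with hr
  set d := sInf (Prod.snd '' U) with hd
  set t := sSup (Prod.snd '' U) with ht
  have hmem : ∀ p ∈ L, ∃ q ∈ Q, q.piece = p := by
    intro p hp
    rw [← hQ.1] at hp
    exact List.mem_map.1 hp
  have hwidth : ∀ p ∈ L, p.width ≤ r - l := by
    intro p hp
    obtain ⟨q, hq, rfl⟩ := hmem p hp
    obtain ⟨h1, h2, -, -⟩ := hbox q hq
    linarith
  have hheight : ∀ p ∈ L, p.height ≤ t - d := by
    intro p hp
    obtain ⟨q, hq, rfl⟩ := hmem p hp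
    obtain ⟨-, -, h1, h2⟩ := hbox q hq
    linarith
  obtain ⟨p, hp⟩ := List.exists_mem_of_ne_nil L hL
  have hW : 0 ≤ r - l := p.width_pos.le.trans (hwidth p hp)
  have hH : 0 ≤ t - d := p.height_pos.le.trans (hheight p hp)
  refine ⟨r - l, t - d, rfl, hwidth, hheight, ?_⟩
  have hdisj : Pairwise fun i j : Fin Q.length =>
      Disjoint (interior Q[i].region) (interior Q[j].region) := by
    have key : ∀ i j : Fin Q.length, i < j →
        Disjoint (interior Q[i].region) (interior Q[j].region) := fun i j hij =>
      List.pairwise_iff_getElem.1 hQ.2 i j i.2 j.2 hij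
    intro i j hij
    rcases lt_or_gt_of_ne hij with h | h
    · exact key i j h
    · exact (key j i h).symm
  have hvol : MeasureTheory.volume (⋃ i : Fin Q.length, interior Q[i].region) =
      ENNReal.ofReal (L.map fun p => p.width * p.height).sum := by
    rw [MeasureTheory.measure_iUnion hdisj fun i => isOpen_interior.measurableSet, tsum_fintype]
    simp only [volume_interior_region]
    rw [← ENNReal.ofReal_sum_of_nonneg fun i _ =>
      (mul_pos Q[i].piece.width_pos Q[i].piece.height_pos).le]
    congr 1
    rw [← hQ.1, List.map_map]
    exact Fin.sum_univ_fun_getElem Q fun q => q.piece.width * q.piece.height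
  have hle : MeasureTheory.volume (⋃ i : Fin Q.length, interior Q[i].region) ≤
      MeasureTheory.volume (Icc l r ×ˢ Icc d t) := by
    refine MeasureTheory.measure_mono (Set.iUnion_subset fun i => interior_subset.trans ?_)
    obtain ⟨h1, h2, h3, h4⟩ := hbox Q[i] (List.getElem_mem i.2)
    exact prod_mono (Icc_subset_Icc h1 h2) (Icc_subset_Icc h3 h4)
  rw [hvol, MeasureTheory.Measure.volume_eq_prod, MeasureTheory.Measure.prod_prod,
    Real.volume_Icc, Real.volume_Icc, ← ENNReal.ofReal_mul hW] at hle
  exact (ENNReal.ofReal_le_ofReal_iff (mul_nonneg hW hH)).1 hle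

/-- The cost of a packing in the positive quadrant is at most twice the extent up to a rightmost
piece and a topmost piece. -/
theorem exists_cost_le {P : List PlacedPiece} (hP : P ≠ [])
    (hpos : ∀ q ∈ P, 0 ≤ q.pos.1 ∧ 0 ≤ q.pos.2) :
    ∃ q ∈ P, ∃ q' ∈ P,
      cost P ≤ 2 * (q.pos.1 + q.piece.width + (q'.pos.2 + q'.piece.height)) := by
  have hcomp := isCompact_iUnion_region P
  obtain ⟨q₀, hq₀⟩ := List.exists_mem_of_ne_nil P hP
  have hne : (⋃ q ∈ P, q.region).Nonempty :=
    ⟨q₀.pos, Set.mem_biUnion (t := fun q => PlacedPiece.region q) hq₀ (corner_mem_region q₀)⟩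
  have hquad : ∀ z ∈ ⋃ q ∈ P, q.region, 0 ≤ z.1 ∧ 0 ≤ z.2 := by
    intro z hz
    obtain ⟨q, hq, hz⟩ := Set.mem_iUnion₂.1 hz
    obtain ⟨⟨h1, -⟩, ⟨h2, -⟩⟩ := hz
    exact ⟨(hpos q hq).1.trans h1, (hpos q hq).2.trans h2⟩
  obtain ⟨z, hz, hz1⟩ := (hcomp.image continuous_fst).sSup_mem (hne.image _)
  obtain ⟨z', hz', hz1'⟩ := (hcomp.image continuous_snd).sSup_mem (hne.image _)
  obtain ⟨q, hq, hzq⟩ := Set.mem_iUnion₂.1 hz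
  obtain ⟨q', hq', hzq'⟩ := Set.mem_iUnion₂.1 hz'
  refine ⟨q, hq, q', hq', ?_⟩
  have h1 : 0 ≤ sInf (Prod.fst '' ⋃ q ∈ P, q.region) := by
    refine le_csInf (hne.image _) ?_
    rintro _ ⟨z, hz, rfl⟩
    exact (hquad z hz).1
  have h2 : 0 ≤ sInf (Prod.snd '' ⋃ q ∈ P, q.region) := by
    refine le_csInf (hne.image _) ?_
    rintro _ ⟨z, hz, rfl⟩
    exact (hquad z hz).2
  have h3 := hzq.1.2
  have h4 := hzq'.2.2
  rw [cost, boundingBoxPerimeter]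
  linarith

/-! ### The competitive ratio -/

namespace State

open Classical in
theorem total_eq_fill (S : State) (f : Piece → ℝ) (D : DerivedBrick) :
    total (fun i : Fin S.length => S[i].brick) (fun i => f S[i].piece) D = S.fill f D := by
  have h1 : S.fill f D = (S.map fun e => if e.brick = D then f e.piece else 0).sum := by
    unfold fill piecesIn
    induction S with
    | nil => simp
    | cons e S ih => by_cases h : e.brick = D <;> simp_all
  rw [h1, total, Finset.sum_filter]
  exact Fin.sum_univ_fun_getElem S fun e => if e.brick = D then f e.piece else 0

theorem IsStacked.stacked {S : State} {P : ℤ → Prop} {bw bh : ℤ → ℝ} {cx cy : DerivedBrick → ℝ}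
    {w h : Piece → ℝ} {x y : ℝ × ℝ → ℝ} (hS : S.IsStacked P bw bh cx cy w h x y) :
    Stacked P bw bh cx cy (fun i : Fin S.length => S[i].brick) (fun i => w S[i].piece)
      (fun i => h S[i].piece) (fun i => x S[i].pos) (fun i => y S[i].pos) := by
  have hm : ∀ i : Fin S.length, S[i] ∈ S := fun i => List.getElem_mem i.2
  refine ⟨fun i => hS.wide _ (hm i), fun i => hS.le _ (hm i), fun i => hS.xpos _ (hm i),
    fun i => hS.ylow _ (hm i), fun i hi => ?_, fun i hi => ?_, fun i j hi hne hl => ?_⟩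
  · rw [total_eq_fill]; exact hS.yhigh _ (hm i) hi
  · rw [total_eq_fill]; exact hS.fits _ (hm i) hi
  · rw [total_eq_fill, total_eq_fill]; exact hS.full _ (hm i) _ (hm j) hi hne hl

theorem Good.layout {S : State} (hS : S.Good) {W H : ℝ} (hW : ∀ e ∈ S, e.piece.width ≤ W)
    (hH : ∀ e ∈ S, e.piece.height ≤ H)
    (harea : (S.map fun e => e.piece.width * e.piece.height).sum ≤ W * H) :
    Layout (fun i : Fin S.length => S[i].brick) (fun i => S[i].piece.width)
      (fun i => S[i].piece.height) (fun i => S[i].pos.1) (fun i => S[i].pos.2) W H := by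
  have hm : ∀ i : Fin S.length, S[i] ∈ S := fun i => List.getElem_mem i.2
  refine ⟨fun i => S[i].piece.width_pos, fun i => S[i].piece.height_pos, hS.even.stacked,
    hS.odd.stacked, fun i j => hS.eq_of_comparable _ ⟨_, hm i, rfl⟩ _ ⟨_, hm j, rfl⟩,
    fun i E hl hc => ?_, fun i => hW _ (hm i), fun i => hH _ (hm i), ?_⟩
  · obtain ⟨F, ⟨e, he, rfl⟩, hc⟩ := hS.exists_comparable _ ⟨_, hm i, rfl⟩ E hl hc
    obtain ⟨j, hj, rfl⟩ := List.getElem_of_mem he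
    exact ⟨⟨j, hj⟩, hc⟩
  · refine le_of_eq_of_le ?_ harea
    exact Fin.sum_univ_fun_getElem S fun e => e.piece.width * e.piece.height

theorem Good.pos_nonneg {S : State} (hS : S.Good) {e : PackedPiece} (he : e ∈ S) :
    0 ≤ e.pos.1 ∧ 0 ≤ e.pos.2 := by
  have hf : ∀ k, 0 ≤ (fundamentalBrick k).corner.1 ∧ 0 ≤ (fundamentalBrick k).corner.2 := by
    intro k
    by_cases h : Even k
    · simp only [fundamentalBrick, h, if_true]; exact ⟨le_rfl, by positivity⟩
    · simp only [fundamentalBrick, h, if_false]; exact ⟨by positivity, le_rfl⟩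
  have h1 := hS.region_subset he (corner_mem_region e.toPlacedPiece)
  have h2 := e.brick.region_subset_fundamentalBrick h1
  exact ⟨(hf _).1.trans h2.1.1, (hf _).2.trans h2.2.1⟩

end State

theorem hasCompetitiveRatio_brickTranslation : HasCompetitiveRatio BrickTranslation 3.96 := by
  rintro L hL P ⟨S, hrun, rfl⟩
  refine ⟨hrun.isPacking, ?_⟩
  have hgood := hrun.good
  have hpieces : ∀ e ∈ S, e.piece ∈ L := by
    intro e he
    rw [← hrun.map_piece]
    exact List.mem_map_of_mem he
  have hne : S.map PackedPiece.toPlacedPiece ≠ [] := by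
    intro h
    have h1 := hrun.map_piece
    rw [List.map_eq_nil_iff] at h
    rw [h] at h1
    exact hL h1.symm
  obtain ⟨q, hq, q', hq', hcost⟩ := exists_cost_le hne (by
    intro q hq
    obtain ⟨e, he, rfl⟩ := List.mem_map.1 hq
    exact hgood.pos_nonneg he)
  obtain ⟨e, he, rfl⟩ := List.mem_map.1 hq
  obtain ⟨e', he', rfl⟩ := List.mem_map.1 hq'
  have hkey : cost (S.map PackedPiece.toPlacedPiece) / 3.96 ≤ opt L := by
    refine le_csInf ⟨_, _, hrun.isPacking, rfl⟩ ?_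
    rintro _ ⟨Q, hQ, rfl⟩
    obtain ⟨W, H, hQcost, hW, hH, harea⟩ := hQ.exists_box hL
    have hlayout := hgood.layout (fun e he => hW _ (hpieces e he))
      (fun e he => hH _ (hpieces e he)) (by rwa [← hrun.map_piece, List.map_map] at harea)
    obtain ⟨i, hi, rfl⟩ := List.getElem_of_mem he
    obtain ⟨j, hj, rfl⟩ := List.getElem_of_mem he'
    have hbound := hlayout.bound ⟨i, hi⟩ ⟨j, hj⟩
    simp only [Fin.getElem_fin] at hbound
    rw [div_le_iff₀ (by norm_num), hQcost]
    linarith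
  rw [div_le_iff₀ (by norm_num)] at hkey
  linarith

end BrickPacking

theorem mainTheorem1 :
    (∀ (L : List BrickPacking.Piece) (S : BrickPacking.State), BrickPacking.Run L S →
      ∀ p : BrickPacking.Piece, ∃ D : BrickPacking.DerivedBrick, S.Chooses p D) ∧
    ∃ c : ℝ, c < 4 ∧
      BrickPacking.HasCompetitiveRatio BrickPacking.BrickTranslation c :=
  ⟨fun _ S _ p => S.exists_chooses p, 3.96, by norm_num,
    BrickPacking.hasCompetitiveRatio_brickTranslation⟩
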